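/- A disc packing of the plane is a family of closed discs with pairwise disjoint interiors. It is called compact if every disc $D$ of the packing is surrounded by a ring of discs of the packing, i.e. there are discs $D_1,\dots,D_n$ of the packing, all tangent to $D$, such that $D_i$ is tangent to $D_{i+1}$ for $i=1,\dots,n$ (with $D_{n+1}=D_1$), and such that the centers of $D_1,\dots,D_n$ are met in this order in exactly one full turn around the center of $D$. **Theorem.** Let $r\in(0,1)$. There exists a compact packing of the plane by discs of radius $r$ and $1$, in which discs of both sizes are present, if and only if $r$ is one of the following nine distinct numbers $c_1,\dots,c_9$ (the decimal values are approximations with an error less than $10^{-10}$): - $c_1\approx 0.6375559772$, a root of $x^4-10x^2-8x+9$; - $c_2\approx 0.5451510421$, a root of $(7+4\sqrt3)x^4+(20+12\sqrt3)x^3+(6+4\sqrt3)x^2+(-20-4\sqrt3)x+3$; - $c_3\approx 0.5332964167$, a root of $8x^3+3x^2-2x-1$; - $c_4=\sqrt2-1\approx 0.4142135624$; - $c_5=\bigl(2\sqrt3+1-2\sqrt{1+\sqrt3}\bigr)/3\approx 0.3861061049$; - $c_6=\sin(\pi/12)/(1-\sin(\pi/12))\approx 0.3491981862$; - $c_7=(\sqrt{17}-3)/4\approx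 0.2807764064$; - $c_8=2\sqrt3/3-1\approx 0.1547005384$; - $c_9=5-2\sqrt6\approx 0.1010205144$. -/

import Mathlib

/-- A disc in the Euclidean plane, which is identified with `ℂ`. -/
structure Disc where
  center : ℂ
  radius : ℝ
  radius_pos : 0 < radius

/-- The interiors of the two discs do not meet. -/
def Disc.InteriorDisjoint (D E : Disc) : Prop :=
  Disjoint (Metric.ball D.center D.radius) (Metric.ball E.center E.radius)

/-- The two discs are (externally) tangent. -/
def Disc.Tangent (D E : Disc) : Prop :=
  dist D.center E.center = D.radius + E.radius

/-- A packing of the plane by discs: a family of discs with pairwise disjoint interiors. -/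
def IsPacking (P : Set Disc) : Prop :=
  P.Pairwise Disc.InteriorDisjoint

/-- The angle in `(-π, π]`, counterclockwise positive, under which one passes from the center of
`E` to the center of `F`, as seen from the center of `D`. -/
noncomputable def Disc.angle (D E F : Disc) : ℝ :=
  Complex.arg ((F.center - D.center) / (E.center - D.center))

/-- The discs `E 0, E 1, …, E (n - 1)` (with `E n = E 0`) form a ring around `D`: all of them are
tangent to `D`, each is tangent to the next one cyclically, and, seen from the center of `D`,
they are met in counterclockwise order in exactly one full turn. -/
structure IsRing (D : Disc) (n : ℕ) (E : ℕ → Disc) : Prop where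
  closed : E n = E 0
  tangent_center : ∀ i < n, D.Tangent (E i)
  tangent_next : ∀ i < n, (E i).Tangent (E (i + 1))
  angle_pos : ∀ i < n, 0 < D.angle (E i) (E (i + 1))
  angle_sum : ∑ i ∈ Finset.range n, D.angle (E i) (E (i + 1)) = 2 * Real.pi

/-- A packing is compact if every disc of it is surrounded by a ring of discs of it. -/
def IsCompactPacking (P : Set Disc) : Prop :=
  IsPacking P ∧ ∀ D ∈ P, ∃ (n : ℕ) (E : ℕ → Disc), (∀ i, E i ∈ P) ∧ IsRing D n E

/-- All discs have radius `a` or `b`, and both radii occur. -/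
def HasExactRadii (P : Set Disc) (a b : ℝ) : Prop :=
  Disc.radius '' P = {a, b}

/-- `c 0, …, c 8` are the nine numbers `c₁, …, c₉` of the table: for each of them its exact
description (for three of them an equation) together with its decimal approximation. -/
structure IsTable (c : Fin 9 → ℝ) : Prop where
  exact1 : c 0 ^ 4 - 10 * c 0 ^ 2 - 8 * c 0 + 9 = 0
  exact2 : (7 + 4 * √3) * c 1 ^ 4 + (20 + 12 * √3) * c 1 ^ 3 + (6 + 4 * √3) * c 1 ^ 2
    + (-20 - 4 * √3) * c 1 + 3 = 0
  exact3 : 8 * c 2 ^ 3 + 3 * c 2 ^ 2 - 2 * c 2 - 1 = 0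
  exact4 : c 3 = √2 - 1
  exact5 : c 4 = (2 * √3 + 1 - 2 * √(1 + √3)) / 3
  exact6 : c 5 = Real.sin (Real.pi / 12) / (1 - Real.sin (Real.pi / 12))
  exact7 : c 6 = (√17 - 3) / 4
  exact8 : c 7 = 2 * √3 / 3 - 1
  exact9 : c 8 = 5 - 2 * √6
  decimal1 : |c 0 - 0.6375559772| < 1 / 10 ^ 10
  decimal2 : |c 1 - 0.5451510421| < 1 / 10 ^ 10
  decimal3 : |c 2 - 0.5332964167| < 1 / 10 ^ 10
  decimal4 : |c 3 - 0.4142135624| < 1 / 10 ^ 10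
  decimal5 : |c 4 - 0.3861061049| < 1 / 10 ^ 10
  decimal6 : |c 5 - 0.3491981862| < 1 / 10 ^ 10
  decimal7 : |c 6 - 0.2807764064| < 1 / 10 ^ 10
  decimal8 : |c 7 - 0.1547005384| < 1 / 10 ^ 10
  decimal9 : |c 8 - 0.1010205144| < 1 / 10 ^ 10

/-!
The possible ratios of the radii come from the rings of the small discs. By the law of cosines,
the angle at the center of a disc between two consecutive discs of its ring depends on the three
radii only (`cornerAngle`). So a ring of a small disc gives an equation
`a * α + b * β + c * (π / 3) = 2 * π`, where `α` is the angle between two large discs, `β` the one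
between a large and a small disc, and the number `b` of changes between large and small is even
(`exists_ring_counts`). A ring that contains a large disc has at most five discs, since
`α, β > π / 3`, and this leaves ten equations (`small_ring_cases`). In nine of them, trigonometry
gives the algebraic description of a number of the table, and the remaining one, `5 * α = 2 * π`,
is excluded by the rings of the large discs: their angles are then `60°`, `54°` and approximately
`48.7°`, and no sum of them that involves a small disc is `360°` (`no_mixed_large_ring`).

To find a small disc with a large one in its ring, and a large disc with a small one in its ring,
suppose that all discs of one size have rings of the same size only. Such a ring is a regular
hexagon, and one of its discs is closer to the center of a given disc of the other size, by a
fixed amount. Repeating this step leads to a contradiction (`exists_mixed_ring`).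

Conversely, for each of the nine numbers there is a periodic packing with at most nine orbits of
discs. Tangencies are algebraic identities between the coordinates of the centers. All other
conditions are strict inequalities: the disjointness of the remaining pairs of discs, of which
only finitely many are close to each other up to translation, and the cyclic order of the discs of
the rings. They are verified with integer approximations of the coordinates
(`IntData.Certificate.isCompactPacking`). That the angles of a ring add up to `2 * π`, and not to
a larger multiple, follows from the fact that its discs change only once from the left to the
right side of a line through the center (`sum_arg_div_eq_two_pi`).
-/

namespace CompactPacking

/-! ### Angles in rings -/

/-- The angle at the center of a disc of radius `R` in the triangle spanned by its center and the
centers of two discs of radii `a` and `b`, the three discs being pairwise tangent. -/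
noncomputable def cornerAngle (R a b : ℝ) : ℝ :=
  Real.arccos (1 - 2 * a * b / ((R + a) * (R + b)))

theorem cornerAngle_comm (R a b : ℝ) : cornerAngle R a b = cornerAngle R b a := by
  unfold cornerAngle
  rw [mul_comm (R + a), mul_right_comm]

theorem Tangent.norm_eq {D E : Disc} (h : D.Tangent E) :
    ‖E.center - D.center‖ = D.radius + E.radius := by
  rw [← dist_eq_norm, dist_comm]; exact h

theorem Tangent.sub_ne_zero {D E : Disc} (h : D.Tangent E) : E.center - D.center ≠ 0 := by
  rw [← norm_pos_iff, Tangent.norm_eq h]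
  linarith [D.radius_pos, E.radius_pos]

/-- The law of cosines for three pairwise tangent discs. -/
theorem angle_eq_cornerAngle {D E F : Disc} (hE : D.Tangent E) (hF : D.Tangent F)
    (hEF : E.Tangent F) (hpos : 0 < D.angle E F) :
    D.angle E F = cornerAngle D.radius E.radius F.radius := by
  have hE0 := Tangent.sub_ne_zero hE
  have hF0 := Tangent.sub_ne_zero hF
  have hD := D.radius_pos
  have hEr := E.radius_pos
  have hFr := F.radius_pos
  have hz : (F.center - D.center) / (E.center - D.center) ≠ 0 := div_ne_zero hF0 hE0
  have hn : ‖(F.center - D.center) / (E.center - D.center)‖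
      = (D.radius + F.radius) / (D.radius + E.radius) := by
    rw [norm_div, Tangent.norm_eq hE, Tangent.norm_eq hF]
  have hn1 : ‖(F.center - D.center) / (E.center - D.center) - 1‖
      = (E.radius + F.radius) / (D.radius + E.radius) := by
    rw [div_sub_one hE0, norm_div, Tangent.norm_eq hE, sub_sub_sub_cancel_right,
      Tangent.norm_eq hEF]
  have hcos : Real.cos (D.angle E F)
      = 1 - 2 * E.radius * F.radius / ((D.radius + E.radius) * (D.radius + F.radius)) := by
    unfold Disc.angle
    rw [Complex.cos_arg hz]
    have h1 := Complex.sq_norm ((F.center - D.center) / (E.center - D.center))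
    have h2 := Complex.sq_norm ((F.center - D.center) / (E.center - D.center) - 1)
    rw [hn, Complex.normSq_apply] at h1
    rw [hn1, Complex.normSq_apply] at h2
    rw [hn]
    simp only [Complex.sub_re, Complex.one_re, Complex.sub_im, Complex.one_im, sub_zero] at h2
    set x := ((F.center - D.center) / (E.center - D.center)).re
    set y := ((F.center - D.center) / (E.center - D.center)).im
    have h3 : x = (((D.radius + F.radius) / (D.radius + E.radius)) ^ 2
        - ((E.radius + F.radius) / (D.radius + E.radius)) ^ 2 + 1) / 2 := by linarith
    rw [h3]
    field_simp
    ring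
  unfold cornerAngle
  rw [← hcos, Real.arccos_cos hpos.le]
  exact Complex.arg_le_pi _

theorem cornerAngle_self {R : ℝ} (hR : 0 < R) : cornerAngle R R R = Real.pi / 3 := by
  unfold cornerAngle
  rw [show 1 - 2 * R * R / ((R + R) * (R + R)) = 1 / 2 by field_simp; norm_num,
    ← Real.cos_pi_div_three, Real.arccos_cos] <;> linarith [Real.pi_pos]

/-! ### Cyclic words in two letters -/

/-- In a word with two letters, `a`, `b` and `c` count the pairs of adjacent letters of the three
possible kinds. The number `b` of changes of letter decides whether the word is closed. -/
theorem exists_adjacent_counts (g : Bool → Bool → ℝ) (hg : g false true = g true false)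
    (σ : ℕ → Bool) (n : ℕ) :
    ∃ a b c : ℕ,
      ∑ i ∈ Finset.range n, g (σ i) (σ (i + 1))
        = a * g true true + b * g true false + c * g false false ∧
      (Even b ↔ σ n = σ 0) ∧
      (b = 0 → (0 < a → σ n = true) ∧ (0 < c → σ n = false)) ∧
      (a = 0 → b = 0 → ∀ i < n, σ i = false) ∧
      (c = 0 → b = 0 → ∀ i < n, σ i = true) := by
  induction n with
  | zero => exact ⟨0, 0, 0, by simp⟩
  | succ n ih =>
    obtain ⟨a, b, c, hs, hp, hb, h0, h1⟩ := ih
    simp only [Finset.sum_range_succ, hs, Nat.lt_succ_iff_lt_or_eq]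
    cases hx : σ n <;> cases hy : σ (n + 1) <;> rw [hx] at hp hb
    · refine ⟨a, b, c + 1, by push_cast; ring, hp, ?_, ?_, ?_⟩ <;> grind
    · refine ⟨a, b + 1, c, by rw [hg]; push_cast; ring, ?_, ?_, ?_, ?_⟩ <;> grind
    · refine ⟨a, b + 1, c, by push_cast; ring, ?_, ?_, ?_, ?_⟩ <;> grind
    · refine ⟨a + 1, b, c, by push_cast; ring, hp, ?_, ?_, ?_⟩ <;> grind

/-- The angle condition of a ring in a packing by discs of radii `r` and `1`: there are `a` pairs of
consecutive discs of radius `1`, `b` mixed pairs, and `c` pairs of discs of radius `r`. -/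
theorem exists_ring_counts {r : ℝ} {D : Disc} {n : ℕ} {E : ℕ → Disc} (h : IsRing D n E)
    (hr : ∀ i, (E i).radius = r ∨ (E i).radius = 1) :
    ∃ a b c : ℕ,
      a * cornerAngle D.radius 1 1 + b * cornerAngle D.radius 1 r + c * cornerAngle D.radius r r
        = 2 * Real.pi ∧
      Even b ∧ (b = 0 → a = 0 ∨ c = 0) ∧
      (a = 0 → b = 0 → ∀ i < n, (E i).radius ≠ 1) ∧
      (c = 0 → b = 0 → ∀ i < n, (E i).radius = 1) := by
  classical
  let f : Bool → ℝ := fun t => if t then 1 else r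
  let σ : ℕ → Bool := fun i => decide ((E i).radius = 1)
  have hf : ∀ i, (E i).radius = f (σ i) := by
    intro i
    by_cases h1 : (E i).radius = 1
    · simp [f, σ, h1]
    · simpa [f, σ, h1] using (hr i).resolve_right h1
  obtain ⟨a, b, c, hs, hp, hb, h0, h1⟩ := exists_adjacent_counts
    (fun s t => cornerAngle D.radius (f s) (f t)) (cornerAngle_comm _ _ _) σ n
  have hclosed : σ n = σ 0 := by simp only [σ, h.closed]
  refine ⟨a, b, c, ?_, hp.2 hclosed, ?_, ?_, ?_⟩
  · have : ∑ i ∈ Finset.range n, D.angle (E i) (E (i + 1))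
        = ∑ i ∈ Finset.range n, cornerAngle D.radius (f (σ i)) (f (σ (i + 1))) := by
      refine Finset.sum_congr rfl fun i hi => ?_
      have hi := Finset.mem_range.1 hi
      rw [← hf, ← hf]
      refine angle_eq_cornerAngle (h.tangent_center i hi) ?_ (h.tangent_next i hi)
        (h.angle_pos i hi)
      rcases Nat.lt_or_ge (i + 1) n with h2 | h2
      · exact h.tangent_center _ h2
      · rw [show i + 1 = n by omega, h.closed]
        exact h.tangent_center 0 (by omega)
    rw [h.angle_sum, hs] at this
    simpa [f] using this.symm
  · intro hb0
    by_contra! hne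
    have h2 := hb hb0
    simp_all [Nat.pos_iff_ne_zero]
  · intro ha hb i hi
    simpa [σ] using h0 ha hb i hi
  · intro hc hb i hi
    simpa [σ] using h1 hc hb i hi

/-! ### A disc size whose rings are all monochromatic fills the plane -/

/-- Six unit vectors forming a regular hexagon contain one that makes an angle of at most `π / 4`
with a given vector `v`. -/
theorem exists_hexagon_direction (e : ℕ → ℂ) (he : ‖e 0‖ = 1)
    (hstep : ∀ i < 6, e (i + 1) = e i * Complex.exp ((Real.pi / 3 : ℝ) * Complex.I)) (v : ℂ) :
    ∃ i < 6, ‖v‖ ^ 2 ≤ 2 * ((e i).re * v.re + (e i).im * v.im) ^ 2 ∧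
      0 ≤ (e i).re * v.re + (e i).im * v.im := by
  have hz : Complex.exp ((Real.pi / 3 : ℝ) * Complex.I) = ⟨1 / 2, √3 / 2⟩ := by
    rw [Complex.exp_mul_I, ← Complex.ofReal_cos, ← Complex.ofReal_sin, Real.cos_pi_div_three,
      Real.sin_pi_div_three]
    apply Complex.ext <;> simp
  rw [hz] at hstep
  have h3 : √3 * √3 = 3 := Real.mul_self_sqrt (by norm_num)
  have hv := Complex.sq_norm v
  rw [Complex.normSq_apply] at hv
  have h0 := Complex.sq_norm (e 0)
  rw [Complex.normSq_apply, he] at h0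
  have key : ∀ i, i < 6 → (e (i + 1)).re = (e i).re * (1 / 2) - (e i).im * (√3 / 2) ∧
      (e (i + 1)).im = (e i).re * (√3 / 2) + (e i).im * (1 / 2) := by
    intro i hi
    rw [hstep i hi]
    simp [Complex.mul_re, Complex.mul_im]
  obtain ⟨r1, i1⟩ := key 0 (by norm_num)
  obtain ⟨r2, i2⟩ := key 1 (by norm_num)
  obtain ⟨r3, i3⟩ := key 2 (by norm_num)
  obtain ⟨r4, i4⟩ := key 3 (by norm_num)
  obtain ⟨r5, i5⟩ := key 4 (by norm_num)
  norm_num at r1 i1 r2 i2 r3 i3 r4 i4 r5 i5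
  set x := (e 0).re
  set y := (e 0).im
  have r2' : (e 2).re = -(x / 2) - y * (√3 / 2) := by
    rw [r2, r1, i1]; linear_combination -(x / 4) * h3
  have i2' : (e 2).im = x * (√3 / 2) - y / 2 := by
    rw [i2, r1, i1]; linear_combination -(y / 4) * h3
  have r3' : (e 3).re = -x := by rw [r3, r2', i2']; linear_combination -(x / 4) * h3
  have i3' : (e 3).im = -y := by rw [i3, r2', i2']; linear_combination -(y / 4) * h3
  have r4' : (e 4).re = -(e 1).re := by rw [r4, r3', i3', r1]; ring
  have i4' : (e 4).im = -(e 1).im := by rw [i4, r3', i3', i1]; ring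
  have r5' : (e 5).re = -(e 2).re := by rw [r5, r4', i4', r2]; ring
  have i5' : (e 5).im = -(e 2).im := by rw [i5, r4', i4', i2]; ring
  -- The squares of the projections of `v` to the three diagonals of the hexagon add up to
  -- `3 / 2 * ‖v‖ ^ 2`.
  have hsum : (x * v.re + y * v.im) ^ 2 + ((e 1).re * v.re + (e 1).im * v.im) ^ 2
      + ((e 2).re * v.re + (e 2).im * v.im) ^ 2 = 3 / 2 * ‖v‖ ^ 2 := by
    rw [r1, i1, r2', i2', hv]
    have h0' : x * x = 1 - y * y := by linarith
    linear_combination (-3 / 2 * (v.re * v.re + v.im * v.im)) * h0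
      + (1 / 2 * (y * v.re - x * v.im) ^ 2 ) * h3
  have opp : ∀ i j, i < 6 → j < 6 → (e j).re = -(e i).re → (e j).im = -(e i).im →
      ‖v‖ ^ 2 ≤ 2 * ((e i).re * v.re + (e i).im * v.im) ^ 2 →
      ∃ i < 6, ‖v‖ ^ 2 ≤ 2 * ((e i).re * v.re + (e i).im * v.im) ^ 2 ∧
        0 ≤ (e i).re * v.re + (e i).im * v.im := by
    intro i j hi hj hre him hle
    rcases le_total 0 ((e i).re * v.re + (e i).im * v.im) with h | h
    · exact ⟨i, hi, hle, h⟩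
    · refine ⟨j, hj, ?_, ?_⟩
      · rw [hre, him]; nlinarith
      · rw [hre, him]; linarith
  by_cases c0 : ‖v‖ ^ 2 ≤ 2 * ((e 0).re * v.re + (e 0).im * v.im) ^ 2
  · exact opp 0 3 (by norm_num) (by norm_num) r3' i3' c0
  by_cases c1 : ‖v‖ ^ 2 ≤ 2 * ((e 1).re * v.re + (e 1).im * v.im) ^ 2
  · exact opp 1 4 (by norm_num) (by norm_num) r4' i4' c1
  by_cases c2 : ‖v‖ ^ 2 ≤ 2 * ((e 2).re * v.re + (e 2).im * v.im) ^ 2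
  · exact opp 2 5 (by norm_num) (by norm_num) r5' i5' c2
  push Not at c0 c1 c2
  exfalso
  linarith

/-- In a ring of discs of the same size as the central one, some disc of the ring is closer to a
given point `w`, provided that `w` is farther than `√2 * D.radius` from the center. -/
theorem exists_ring_closer {D : Disc} {n : ℕ} {E : ℕ → Disc} (h : IsRing D n E)
    (hE : ∀ i < n, (E i).radius = D.radius) (w : ℂ) {d : ℝ}
    (hdw : d ≤ dist D.center w) :
    ∃ i < n, dist (E i).center w ^ 2
      ≤ dist D.center w ^ 2 - 4 * D.radius * (d / √2 - D.radius) := by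
  set R := D.radius with hR
  have hRpos : 0 < R := D.radius_pos
  have hn0 : 0 < n := by
    rcases Nat.eq_zero_or_pos n with rfl | h0
    · have := h.angle_sum
      simp at this
    · exact h0
  have hE' : ∀ i ≤ n, (E i).radius = R ∧ D.Tangent (E i) := by
    intro i hi
    rcases hi.lt_or_eq with h1 | rfl
    · exact ⟨hE i h1, h.tangent_center i h1⟩
    · rw [h.closed]; exact ⟨hE 0 hn0, h.tangent_center 0 hn0⟩
  have hang : ∀ i < n, D.angle (E i) (E (i + 1)) = Real.pi / 3 := by
    intro i hi
    rw [angle_eq_cornerAngle (h.tangent_center i hi) (hE' (i + 1) hi).2 (h.tangent_next i hi)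
      (h.angle_pos i hi), hE i hi, (hE' (i + 1) hi).1, ← hR, cornerAngle_self hRpos]
  have hn : n = 6 := by
    have h1 := h.angle_sum
    rw [Finset.sum_congr rfl fun i hi => hang i (Finset.mem_range.1 hi)] at h1
    simp only [Finset.sum_const, Finset.card_range, nsmul_eq_mul] at h1
    have h2 : (n : ℝ) = 6 := by
      have := Real.pi_pos
      field_simp at h1
      linarith
    exact_mod_cast h2
  subst hn
  set e : ℕ → ℂ := fun i => ((E i).center - D.center) / ((2 * R : ℝ) : ℂ) with he
  have h2R : ((2 * R : ℝ) : ℂ) ≠ 0 := by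
    exact_mod_cast (by positivity : (2 * R : ℝ) ≠ 0)
  have hnorm : ∀ i ≤ 6, ‖e i‖ = 1 := by
    intro i hi
    rw [he]
    simp only [norm_div]
    rw [Tangent.norm_eq (hE' i hi).2, (hE' i hi).1, ← hR, Complex.norm_real, Real.norm_eq_abs,
      abs_of_pos (by positivity)]
    field_simp
    norm_num
  have hstep : ∀ i < 6, e (i + 1) = e i * Complex.exp ((Real.pi / 3 : ℝ) * Complex.I) := by
    intro i hi
    have hne := Tangent.sub_ne_zero (hE' i hi.le).2
    have h1 : e (i + 1) / e i
        = ((E (i + 1)).center - D.center) / ((E i).center - D.center) := by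
      rw [he]; field_simp
    have h2 := Complex.norm_mul_exp_arg_mul_I (e (i + 1) / e i)
    have h3 : Complex.arg (e (i + 1) / e i) = Real.pi / 3 := by rw [h1]; exact hang i hi
    have hei : e i ≠ 0 := by rw [← norm_pos_iff, hnorm i hi.le]; norm_num
    rw [h3, norm_div, hnorm _ hi.le, hnorm _ hi] at h2
    rw [eq_comm, mul_comm, ← eq_div_iff hei]
    simpa using h2
  obtain ⟨i, hi, h1, h2⟩ := exists_hexagon_direction e (hnorm 0 (by norm_num)) hstep
    (w - D.center)
  refine ⟨i, hi, ?_⟩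
  have hc : (E i).center = D.center + (2 * R : ℝ) * e i := by
    simp only [he]; field_simp; ring
  have hv : ‖w - D.center‖ = dist D.center w := by rw [dist_comm, dist_eq_norm]
  rw [hv] at h1
  set p := (e i).re * (w - D.center).re + (e i).im * (w - D.center).im
  have hp : d / √2 ≤ p := by
    rw [div_le_iff₀ (by positivity)]
    refine le_trans hdw (abs_le_of_sq_le_sq' ?_ (by positivity)).2
    rw [mul_pow, Real.sq_sqrt (by norm_num)]
    linarith
  have hdist : dist (E i).center w ^ 2 = dist D.center w ^ 2 - 4 * R * p + 4 * R ^ 2 := by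
    have h0 := Complex.sq_norm (e i)
    rw [hnorm i hi.le, Complex.normSq_apply] at h0
    rw [dist_comm, dist_eq_norm, ← hv, Complex.sq_norm, Complex.sq_norm, Complex.normSq_apply,
      Complex.normSq_apply, hc]
    simp only [p, Complex.sub_re, Complex.sub_im, Complex.add_re, Complex.add_im,
      Complex.mul_re, Complex.mul_im, Complex.ofReal_re, Complex.ofReal_im]
    linear_combination (-4 * R ^ 2) * h0
  rw [hdist]
  nlinarith

/-- If every disc of radius `R` of a compact packing were surrounded by discs of radius `R` only,
one could walk along them into any disc of another radius `ρ`. -/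
theorem exists_mixed_ring {P : Set Disc} (hP : IsCompactPacking P) {D F : Disc} (hD : D ∈ P)
    (hF : F ∈ P) (hne : D.radius ≠ F.radius) (hbig : √2 * D.radius < D.radius + F.radius) :
    ∃ D' ∈ P, D'.radius = D.radius ∧ ∃ (n : ℕ) (E : ℕ → Disc), (∀ i, E i ∈ P) ∧ IsRing D' n E ∧
      ∃ i < n, (E i).radius ≠ D.radius := by
  by_contra! hcon
  set R := D.radius with hR
  have hRpos : 0 < R := D.radius_pos
  have hFpos := F.radius_pos
  set δ := 4 * R * ((R + F.radius) / √2 - R) with hδ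
  have h2 : (0 : ℝ) < √2 := by positivity
  have hδpos : 0 < δ := by
    have : R < (R + F.radius) / √2 := by rw [lt_div_iff₀ h2]; linarith
    have : 0 < (R + F.radius) / √2 - R := by linarith
    positivity
  have hwalk : ∀ k : ℕ, ∃ D' ∈ P, D'.radius = R ∧
      dist D'.center F.center ^ 2 ≤ dist D.center F.center ^ 2 - k * δ := by
    intro k
    induction k with
    | zero => exact ⟨D, hD, rfl, by simp⟩
    | succ k ih =>
      obtain ⟨D', hD', hr', hk⟩ := ih
      obtain ⟨n, E, hEP, hring⟩ := hP.2 D' hD'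
      have hall := hcon D' hD' hr' n E hEP hring
      have hdisj := hP.1 hD' hF (by rintro rfl; exact hne hr'.symm)
      have hsep : R + F.radius ≤ dist D'.center F.center := by
        rw [← hr']
        exact (disjoint_ball_ball_iff D'.radius_pos F.radius_pos).1 hdisj
      obtain ⟨i, hi, hle⟩ := exists_ring_closer hring (fun i hi => by rw [hall i hi, hr']) F.center
        hsep
      refine ⟨E i, hEP i, hall i hi, ?_⟩
      rw [hr'] at hle
      push_cast
      linarith
  obtain ⟨k, hk⟩ := exists_nat_gt (dist D.center F.center ^ 2 / δ)
  obtain ⟨D', -, -, h⟩ := hwalk k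
  rw [div_lt_iff₀ hδpos] at hk
  nlinarith [sq_nonneg (dist D'.center F.center)]

/-! ### The rings of the small discs -/

theorem cornerAngle_small_large_large {r : ℝ} (hr : 0 < r) :
    0 < cornerAngle r 1 1 / 2 ∧ cornerAngle r 1 1 / 2 < Real.pi / 2 ∧
      Real.sin (cornerAngle r 1 1 / 2) = 1 / (1 + r) ∧
      Real.cos (cornerAngle r 1 1) = 1 - 2 / (1 + r) ^ 2 := by
  have hcos : Real.cos (cornerAngle r 1 1) = 1 - 2 / (1 + r) ^ 2 := by
    unfold cornerAngle
    have h1 : 2 * 1 * 1 / ((r + 1) * (r + 1)) = 2 / (1 + r) ^ 2 := by ring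
    rw [h1, Real.cos_arccos]
    · have : 2 / (1 + r) ^ 2 ≤ 2 := div_le_self (by norm_num) (by nlinarith)
      linarith
    · have : 0 ≤ 2 / (1 + r) ^ 2 := by positivity
      linarith
  have hlt : cornerAngle r 1 1 < Real.pi := by
    refine lt_of_le_of_ne (Real.arccos_le_pi _) fun h => ?_
    rw [h, Real.cos_pi] at hcos
    have : 2 / (1 + r) ^ 2 < 2 := div_lt_self (by norm_num) (by nlinarith)
    linarith
  have hpos : 0 < cornerAngle r 1 1 := by
    refine lt_of_le_of_ne (Real.arccos_nonneg _) fun h => ?_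
    rw [← h, Real.cos_zero] at hcos
    have : 0 < 2 / (1 + r) ^ 2 := by positivity
    linarith
  refine ⟨by linarith, by linarith, ?_, hcos⟩
  have h1 : 0 < Real.sin (cornerAngle r 1 1 / 2) :=
    Real.sin_pos_of_pos_of_lt_pi (by linarith) (by linarith)
  have h2 := Real.cos_sq (cornerAngle r 1 1 / 2)
  rw [show 2 * (cornerAngle r 1 1 / 2) = cornerAngle r 1 1 by ring, hcos] at h2
  have h3 := Real.sin_sq_add_cos_sq (cornerAngle r 1 1 / 2)
  have h4 : (0 : ℝ) < 1 / (1 + r) := by positivity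
  have h5 : Real.sin (cornerAngle r 1 1 / 2) ^ 2 = (1 / (1 + r)) ^ 2 := by
    rw [one_div, inv_pow]
    rw [div_eq_mul_inv 2] at h2
    linarith
  exact (sq_eq_sq₀ h1.le h4.le).1 h5

theorem cornerAngle_small_large_small {r : ℝ} (hr : 0 < r) :
    cornerAngle r 1 r < Real.pi / 2 ∧ 0 < cornerAngle r 1 r ∧
      Real.cos (cornerAngle r 1 r) = r / (1 + r) := by
  have h1 : 1 - 2 * 1 * r / ((r + 1) * (r + r)) = r / (1 + r) := by field_simp; ring
  have h0 : 0 < r / (1 + r) := by positivity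
  have h2 : r / (1 + r) < 1 := by rw [div_lt_one (by positivity)]; linarith
  unfold cornerAngle
  rw [h1]
  exact ⟨by rwa [Real.arccos_lt_pi_div_two], by rwa [Real.arccos_pos],
    Real.cos_arccos (by linarith) h2.le⟩

theorem pi_div_three_lt_cornerAngles {r : ℝ} (hr : 0 < r) (hr1 : r < 1) :
    Real.pi / 3 < cornerAngle r 1 1 ∧ Real.pi / 3 < cornerAngle r 1 r := by
  obtain ⟨h1, h2, -, h3⟩ := cornerAngle_small_large_large hr
  obtain ⟨h4, h5, h6⟩ := cornerAngle_small_large_small hr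
  have hpi := Real.pi_pos
  constructor
  · by_contra! hcon
    have := Real.cos_le_cos_of_nonneg_of_le_pi (by linarith) (by linarith) hcon
    rw [Real.cos_pi_div_three, h3] at this
    have : 1 / 2 < 2 / (1 + r) ^ 2 := by
      rw [div_lt_div_iff₀ (by norm_num) (by positivity)]; nlinarith
    linarith
  · by_contra! hcon
    have := Real.cos_le_cos_of_nonneg_of_le_pi (by linarith) (by linarith) hcon
    rw [Real.cos_pi_div_three, h6, div_le_div_iff₀ (by norm_num) (by positivity)] at this
    linarith

/-- The ten possible rings of a small disc that contain a large disc. Here `α` is the angle at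
the small disc between two large discs, and `β` the one between a large and a small disc. -/
theorem small_ring_cases {α β : ℝ} (hα : Real.pi / 3 < α) (hα' : α < Real.pi)
    (hβ : Real.pi / 3 < β) (hβ' : β < Real.pi / 2) {a b c : ℕ}
    (hsum : a * α + b * β + c * (Real.pi / 3) = 2 * Real.pi) (hb : Even b)
    (h0 : b = 0 → a = 0 ∨ c = 0) (hab : ¬ (a = 0 ∧ b = 0)) :
    3 * α = 2 * Real.pi ∨ 4 * α = 2 * Real.pi ∨ 5 * α = 2 * Real.pi ∨
    α + 2 * β + Real.pi / 3 = 2 * Real.pi ∨ α + 2 * β + 2 * (Real.pi / 3) = 2 * Real.pi ∨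
    2 * α + 2 * β = 2 * Real.pi ∨ 2 * α + 2 * β + Real.pi / 3 = 2 * Real.pi ∨
    3 * α + 2 * β = 2 * Real.pi ∨ α + 4 * β = 2 * Real.pi ∨
    4 * β + Real.pi / 3 = 2 * Real.pi := by
  have hpi := Real.pi_pos
  have hn : a + b + c < 6 := by
    by_contra! hge
    have hge' : (6 : ℝ) ≤ a + b + c := by exact_mod_cast hge
    have h1 : (1 : ℝ) ≤ a + b := by
      have : 1 ≤ a + b := by omega
      exact_mod_cast this
    have ha0 : (0 : ℝ) ≤ a := a.cast_nonneg
    have hb0 : (0 : ℝ) ≤ b := b.cast_nonneg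
    obtain ⟨ε, hε, hεα, hεβ⟩ : ∃ ε > 0, Real.pi / 3 + ε ≤ α ∧ Real.pi / 3 + ε ≤ β :=
      ⟨min (α - Real.pi / 3) (β - Real.pi / 3), by simp [hα, hβ],
        by linarith [min_le_left (α - Real.pi / 3) (β - Real.pi / 3)],
        by linarith [min_le_right (α - Real.pi / 3) (β - Real.pi / 3)]⟩
    have := mul_le_mul_of_nonneg_left hεα ha0
    have := mul_le_mul_of_nonneg_left hεβ hb0
    nlinarith
  have ha6 : a ≤ 5 := by omega
  have hb6 : b = 0 ∨ b = 2 ∨ b = 4 := by obtain ⟨k, hk⟩ := hb; omega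
  have hc6 : c ≤ 5 := by omega
  rcases hb6 with rfl | rfl | rfl
  · have hc : c = 0 := by have := h0 rfl; omega
    subst hc
    have ha1 : 1 ≤ a := by omega
    interval_cases a <;> norm_num at hsum ⊢ <;>
      first
        | (exfalso; linarith)
        | exact Or.inl hsum
        | exact Or.inr (Or.inl hsum)
        | exact Or.inr (Or.inr (Or.inl hsum))
  · have hc3 : c ≤ 3 := by omega
    have ha3 : a ≤ 3 := by omega
    interval_cases a <;> interval_cases c <;> first | omega | skip
    all_goals
      norm_num at hsum
      first
        | (exfalso; linarith)
        | (have : α + 2 * β + Real.pi / 3 = 2 * Real.pi := by linarith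
           simp [this])
        | (have : α + 2 * β + 2 * (Real.pi / 3) = 2 * Real.pi := by linarith
           simp [this])
        | (have : 2 * α + 2 * β = 2 * Real.pi := by linarith
           simp [this])
        | (have : 2 * α + 2 * β + Real.pi / 3 = 2 * Real.pi := by linarith
           simp [this])
        | (have : 3 * α + 2 * β = 2 * Real.pi := by linarith
           simp [this])
  · have hc3 : c ≤ 1 := by omega
    have ha3 : a ≤ 1 := by omega
    interval_cases a <;> interval_cases c <;> first | omega | skip
    all_goals
      norm_num at hsum
      first
        | (exfalso; linarith)
        | (have : α + 4 * β = 2 * Real.pi := by linarith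
           simp [this])
        | (have : 4 * β + Real.pi / 3 = 2 * Real.pi := by linarith
           simp [this])

theorem sin_pi_div_five_bounds :
    0.5877 < Real.sin (Real.pi / 5) ∧ Real.sin (Real.pi / 5) < 0.5879 := by
  have hpi := Real.pi_pos
  have hs0 : 0 < Real.sin (Real.pi / 5) :=
    Real.sin_pos_of_pos_of_lt_pi (by linarith) (by linarith)
  have hsq := Real.sin_sq_add_cos_sq (Real.pi / 5)
  have h5l : (2.236 : ℝ) < √5 := by rw [Real.lt_sqrt] <;> norm_num
  have h5u : √5 < 2.2361 := by rw [Real.sqrt_lt'] <;> norm_num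
  have h5 : √5 ^ 2 = 5 := Real.sq_sqrt (by norm_num)
  rw [Real.cos_pi_div_five] at hsq
  constructor
  · refine lt_of_pow_lt_pow_left₀ 2 hs0.le ?_
    norm_num1
    linarith
  · refine lt_of_pow_lt_pow_left₀ 2 (by norm_num) ?_
    norm_num1
    linarith

/-- If five large discs fit around a small disc, then the angle at a large disc between two small
discs lies between `48°` and `50.4°`. -/
theorem cornerAngle_large_small_small_bounds {r : ℝ} (hr : 0 < r)
    (hsin : Real.sin (Real.pi / 5) = 1 / (1 + r)) :
    4 * Real.pi / 15 < cornerAngle 1 r r ∧ cornerAngle 1 r r < 7 * Real.pi / 25 := by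
  have hpi := Real.pi_pos
  have hpi3 := Real.pi_gt_d2
  have hpi4 := Real.pi_lt_d2
  have hδ0 : 0 ≤ cornerAngle 1 r r := Real.arccos_nonneg _
  have hδpi : cornerAngle 1 r r ≤ Real.pi := Real.arccos_le_pi _
  -- Half the angle has the sine `r / (1 + r) = 1 - sin (π / 5)`.
  have hcosδ : Real.cos (cornerAngle 1 r r) = 1 - 2 * (1 - Real.sin (Real.pi / 5)) ^ 2 := by
    unfold cornerAngle
    rw [hsin, Real.cos_arccos]
    · field_simp; ring
    · rw [neg_le_sub_iff_le_add, div_le_iff₀ (by positivity)]; nlinarith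
    · have : 0 ≤ 2 * r * r / ((1 + r) * (1 + r)) := by positivity
      linarith
  have key : ∀ x, Real.cos (2 * x) = 1 - 2 * Real.sin x ^ 2 := fun x => by
    rw [Real.cos_two_mul, Real.cos_sq']; ring
  obtain ⟨hsl, hsu⟩ := sin_pi_div_five_bounds
  constructor
  · by_contra! hcon
    have h1 := Real.cos_le_cos_of_nonneg_of_le_pi hδ0 (by linarith) hcon
    rw [show 4 * Real.pi / 15 = 2 * (2 * Real.pi / 15) by ring, key, hcosδ] at h1
    have h4 : Real.sin (2 * Real.pi / 15) < 0.412 := by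
      rw [show 2 * Real.pi / 15 = Real.pi / 3 - Real.pi / 5 by ring, Real.sin_sub,
        Real.cos_pi_div_three, Real.sin_pi_div_three, Real.cos_pi_div_five]
      have h3u : √3 < 1.7321 := by rw [Real.sqrt_lt'] <;> norm_num
      have h5u : √5 < 2.2361 := by rw [Real.sqrt_lt'] <;> norm_num
      have h6 : √3 / 2 * ((1 + √5) / 4) ≤ 1.7321 / 2 * ((1 + 2.2361) / 4) := by gcongr
      norm_num at h6 hsl ⊢
      linarith
    have h5 : 0 < Real.sin (2 * Real.pi / 15) :=
      Real.sin_pos_of_pos_of_lt_pi (by linarith) (by linarith)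
    have h7 : Real.sin (2 * Real.pi / 15) ^ 2 < (1 - Real.sin (Real.pi / 5)) ^ 2 :=
      pow_lt_pow_left₀ (by linarith) h5.le two_ne_zero
    linarith
  · by_contra! hcon
    have h1 := Real.cos_le_cos_of_nonneg_of_le_pi (by linarith) hδpi hcon
    rw [show 7 * Real.pi / 25 = 2 * (7 * Real.pi / 50) by ring, key, hcosδ] at h1
    have h4 : 0.415 < Real.sin (7 * Real.pi / 50) := by
      have h5 := Real.sin_gt_sub_cube (x := 0.439) (by norm_num)
      have h6 := Real.sin_le_sin_of_le_of_le_pi_div_two (x := 0.439) (y := 7 * Real.pi / 50)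
        (by linarith) (by linarith) (by linarith)
      norm_num at h5 h6 ⊢
      linarith
    have h7 : (1 - Real.sin (Real.pi / 5)) ^ 2 < Real.sin (7 * Real.pi / 50) ^ 2 :=
      pow_lt_pow_left₀ (by linarith) (by linarith) two_ne_zero
    linarith

/-- If five large discs fit around a small disc, then no ring of a large disc contains a small
disc: the angles at the large disc are `60°`, `54°` and one between `48°` and `50.4°`, and no mixed
sum of them is `360°`. -/
theorem no_mixed_large_ring {r : ℝ} (hr : 0 < r)
    (h5 : 5 * cornerAngle r 1 1 = 2 * Real.pi) {a b c : ℕ}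
    (hsum : a * cornerAngle 1 1 1 + b * cornerAngle 1 1 r + c * cornerAngle 1 r r = 2 * Real.pi)
    (hb : Even b) (h0 : b = 0 → a = 0 ∨ c = 0) : b = 0 ∧ c = 0 := by
  obtain ⟨-, -, hsin, -⟩ := cornerAngle_small_large_large hr
  have hpi := Real.pi_pos
  rw [show cornerAngle r 1 1 / 2 = Real.pi / 5 by linarith] at hsin
  have h11 : cornerAngle 1 1 1 = Real.pi / 3 := cornerAngle_self one_pos
  have h1r : cornerAngle 1 1 r = 3 * Real.pi / 10 := by
    unfold cornerAngle
    rw [show 1 - 2 * 1 * r / ((1 + 1) * (1 + r)) = 1 / (1 + r) by field_simp; ring, ← hsin,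
      ← Real.cos_pi_div_two_sub, Real.arccos_cos] <;> linarith
  obtain ⟨hδl, hδu⟩ := cornerAngle_large_small_small_bounds hr hsin
  generalize cornerAngle 1 r r = δ at *
  rw [h11, h1r] at hsum
  -- The ring consists of six or seven discs.
  have hn6 : 6 ≤ a + b + c := by
    by_contra! hlt
    have : ((a + b + c : ℕ) : ℝ) ≤ 5 := by exact_mod_cast Nat.lt_succ_iff.1 hlt
    push_cast at this
    nlinarith [a.cast_nonneg (α := ℝ), b.cast_nonneg (α := ℝ), c.cast_nonneg (α := ℝ)]
  have hn7 : a + b + c ≤ 7 := by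
    by_contra! hlt
    have : (8 : ℝ) ≤ ((a + b + c : ℕ) : ℝ) := by exact_mod_cast hlt
    push_cast at this
    nlinarith [a.cast_nonneg (α := ℝ), b.cast_nonneg (α := ℝ), c.cast_nonneg (α := ℝ)]
  have hb' : b ≤ 7 := by omega
  have hc' : c ≤ 7 := by omega
  obtain h6 | h7 : a + b + c = 6 ∨ a + b + c = 7 := by omega
  · have ha : (a : ℝ) = 6 - b - c := by
      have : ((a + b + c : ℕ) : ℝ) = 6 := by exact_mod_cast h6
      push_cast at this; linarith
    rw [ha] at hsum
    by_contra hne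
    have h1 : (1 : ℝ) ≤ b + c := by
      have : 1 ≤ b + c := by omega
      exact_mod_cast this
    nlinarith [b.cast_nonneg (α := ℝ), c.cast_nonneg (α := ℝ)]
  · have ha : (a : ℝ) = 7 - b - c := by
      have : ((a + b + c : ℕ) : ℝ) = 7 := by exact_mod_cast h7
      push_cast at this; linarith
    rw [ha] at hsum
    exfalso
    have hb6 : b = 0 ∨ b = 2 ∨ b = 4 ∨ b = 6 := by obtain ⟨k, hk⟩ := hb; omega
    rcases hb6 with rfl | rfl | rfl | rfl <;> norm_num at h0 <;> interval_cases c <;>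
      first
        | omega
        | (norm_num at hsum; linarith)

theorem exists_radius_eq {P : Set Disc} {r : ℝ} (h : HasExactRadii P r 1) :
    (∀ D ∈ P, D.radius = r ∨ D.radius = 1) ∧ (∃ D ∈ P, D.radius = r) ∧ ∃ D ∈ P, D.radius = 1 := by
  unfold HasExactRadii at h
  refine ⟨fun D hD => ?_, ?_, ?_⟩
  · have : D.radius ∈ Disc.radius '' P := ⟨D, hD, rfl⟩
    rw [h] at this
    simpa using this
  · have : r ∈ Disc.radius '' P := by rw [h]; simp
    obtain ⟨D, hD, h⟩ := this
    exact ⟨D, hD, h⟩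
  · have : (1 : ℝ) ∈ Disc.radius '' P := by rw [h]; simp
    obtain ⟨D, hD, h⟩ := this
    exact ⟨D, hD, h⟩

/-- The nine equations, one of which the ratio of the radii of a compact packing has to satisfy.
`α` and `β` are the angles at a small disc between two large discs, and between a large and a
small disc. -/
theorem angle_equation_of_packing {r : ℝ} (hr : 0 < r) (hr1 : r < 1) {P : Set Disc}
    (hP : IsCompactPacking P) (hPr : HasExactRadii P r 1) {α β : ℝ} (hα : α = cornerAngle r 1 1)
    (hβ : β = cornerAngle r 1 r) :
    3 * α = 2 * Real.pi ∨ 4 * α = 2 * Real.pi ∨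
    α + 2 * β + Real.pi / 3 = 2 * Real.pi ∨ α + 2 * β + 2 * (Real.pi / 3) = 2 * Real.pi ∨
    2 * α + 2 * β = 2 * Real.pi ∨ 2 * α + 2 * β + Real.pi / 3 = 2 * Real.pi ∨
    3 * α + 2 * β = 2 * Real.pi ∨ α + 4 * β = 2 * Real.pi ∨
    4 * β + Real.pi / 3 = 2 * Real.pi := by
  obtain ⟨hrad, ⟨S, hS, hSr⟩, ⟨L, hL, hLr⟩⟩ := exists_radius_eq hPr
  have hs2 : √2 < 1.415 := by rw [Real.sqrt_lt'] <;> norm_num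
  obtain ⟨hα1, hβ1⟩ := pi_div_three_lt_cornerAngles hr hr1
  obtain ⟨-, hα2, hsin, -⟩ := cornerAngle_small_large_large hr
  obtain ⟨hβ2, -, -⟩ := cornerAngle_small_large_small hr
  obtain ⟨D, hD, hDr, n, E, hEP, hring, i, hi, hEi⟩ := exists_mixed_ring hP hS hL
    (by rw [hSr, hLr]; exact hr1.ne) (by rw [hSr, hLr]; nlinarith)
  obtain ⟨a, b, c, hsum, hb, h0, hall, -⟩ :=
    exists_ring_counts (r := r) hring fun i => hrad _ (hEP i)
  rw [hDr, hSr, cornerAngle_self hr, ← hα, ← hβ] at hsum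
  rw [← hα] at hα1 hα2
  rw [← hβ] at hβ1 hβ2
  have hcases := small_ring_cases hα1 (by linarith) hβ1 hβ2 hsum hb h0 (by
    rintro ⟨ha0, hb0⟩
    rcases hrad _ (hEP i) with h | h
    · exact hEi (by rw [h, hSr])
    · exact hall ha0 hb0 i hi h)
  rcases hcases with h | h | h5 | h
  · exact Or.inl h
  · exact Or.inr (Or.inl h)
  · exfalso
    -- Around some large disc, there is a small disc.
    have hrbig : 1 / 2 < r := by
      have h36 : Real.sin (α / 2) < 2 / 3 := by
        rw [show α / 2 = Real.pi / 5 by linarith]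
        have h1 := Real.cos_pi_div_five
        have h2 := Real.sin_sq_add_cos_sq (Real.pi / 5)
        have h5l : (2.2 : ℝ) < √5 := by rw [Real.lt_sqrt] <;> norm_num
        rw [h1] at h2
        nlinarith
      rw [hα, hsin, div_lt_div_iff₀ (by positivity) (by norm_num)] at h36
      linarith
    obtain ⟨D', hD', hDr', n', E', hEP', hring', i', hi', hEi'⟩ := exists_mixed_ring hP hL hS
      (by rw [hSr, hLr]; exact hr1.ne') (by rw [hSr, hLr]; linarith)
    obtain ⟨a', b', c', hsum', hb', h0', -, hall'⟩ :=
      exists_ring_counts (r := r) hring' fun i => hrad _ (hEP' i)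
    rw [hDr', hLr] at hsum'
    obtain ⟨h1, h2⟩ := no_mixed_large_ring hr (by rw [← hα]; exact h5) hsum' hb' h0'
    exact hEi' (by rw [hall' h2 h1 i' hi', hLr])
  · exact Or.inr (Or.inr h)

/-! ### From the angle equations to the table -/

section Equations

variable {r : ℝ}

/-- The relations between the two angles at a small disc and the radius, in terms of the positive
number `m = √(1 + 2 * r)`. -/
theorem exists_angle_relations (hr : 0 < r) :
    ∃ m : ℝ, 0 < m ∧ m ^ 2 = 1 + 2 * r ∧
      Real.cos (cornerAngle r 1 r) = r / (1 + r) ∧ Real.sin (cornerAngle r 1 r) = m / (1 + r) ∧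
      Real.sin (cornerAngle r 1 1 / 2) = 1 / (1 + r) ∧
      Real.cos (cornerAngle r 1 1) = 1 - 2 / (1 + r) ^ 2 := by
  obtain ⟨h1, h2, hcos⟩ := cornerAngle_small_large_small hr
  obtain ⟨-, -, h3, h4⟩ := cornerAngle_small_large_large hr
  have hs : 0 < Real.sin (cornerAngle r 1 r) :=
    Real.sin_pos_of_pos_of_lt_pi h2 (by linarith [Real.pi_pos])
  refine ⟨Real.sin (cornerAngle r 1 r) * (1 + r), by positivity, ?_, hcos, by field_simp, h3, h4⟩
  rw [mul_pow, Real.sin_sq, hcos]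
  field_simp
  ring

theorem eq_of_three_alpha (hr : 0 < r) (h : 3 * cornerAngle r 1 1 = 2 * Real.pi) :
    r = 2 * √3 / 3 - 1 := by
  obtain ⟨m, -, -, -, -, hs, -⟩ := exists_angle_relations hr
  rw [show cornerAngle r 1 1 / 2 = Real.pi / 3 by linarith, Real.sin_pi_div_three] at hs
  have h3 : √3 ^ 2 = 3 := Real.sq_sqrt (by norm_num)
  field_simp at hs
  linear_combination (√3 / 3) * hs - (1 + r) / 3 * h3

theorem eq_of_four_alpha (hr : 0 < r) (h : 4 * cornerAngle r 1 1 = 2 * Real.pi) :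
    r = √2 - 1 := by
  obtain ⟨m, -, -, -, -, hs, -⟩ := exists_angle_relations hr
  rw [show cornerAngle r 1 1 / 2 = Real.pi / 4 by linarith, Real.sin_pi_div_four] at hs
  have h3 : √2 ^ 2 = 2 := Real.sq_sqrt (by norm_num)
  field_simp at hs
  linear_combination (√2 / 2) * hs - (1 + r) / 2 * h3

theorem eq_of_alpha_two_beta (hr : 0 < r) (hr1 : r < 1)
    (h : cornerAngle r 1 1 + 2 * cornerAngle r 1 r + Real.pi / 3 = 2 * Real.pi) :
    r = 5 - 2 * √6 := by
  obtain ⟨m, -, hm2, hc, hs, hq, -⟩ := exists_angle_relations hr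
  rw [show cornerAngle r 1 1 / 2 = Real.pi / 2 - (cornerAngle r 1 r - Real.pi / 3) by linarith,
    Real.sin_pi_div_two_sub, Real.cos_sub, hc, hs, Real.cos_pi_div_three,
    Real.sin_pi_div_three] at hq
  have h3 : √3 ^ 2 = 3 := Real.sq_sqrt (by norm_num)
  have h6 : √6 ^ 2 = 6 := Real.sq_sqrt (by norm_num)
  have h6' := Real.sqrt_nonneg 6
  field_simp at hq
  have hq' : m * √3 = 2 - r := by linarith
  have h1 : (m * √3) ^ 2 = (2 - r) ^ 2 := by rw [hq']
  rw [mul_pow, hm2, h3] at h1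
  have h2 : (5 - r) ^ 2 = (2 * √6) ^ 2 := by rw [mul_pow, h6]; linarith
  have := (sq_eq_sq₀ (by linarith) (by positivity)).1 h2
  linarith

theorem eq_of_alpha_two_beta' (hr : 0 < r) (hr1 : r < 1)
    (h : cornerAngle r 1 1 + 2 * cornerAngle r 1 r + 2 * (Real.pi / 3) = 2 * Real.pi) :
    r = (2 * √3 + 1 - 2 * √(1 + √3)) / 3 := by
  obtain ⟨m, -, hm2, hc, hs, hq, -⟩ := exists_angle_relations hr
  rw [show cornerAngle r 1 1 / 2 = Real.pi / 2 - (cornerAngle r 1 r - Real.pi / 6) by linarith,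
    Real.sin_pi_div_two_sub, Real.cos_sub, hc, hs, Real.cos_pi_div_six,
    Real.sin_pi_div_six] at hq
  have h3 : √3 ^ 2 = 3 := Real.sq_sqrt (by norm_num)
  have h3' : 1 ≤ √3 := by rw [Real.one_le_sqrt]; norm_num
  have h6 : √(1 + √3) ^ 2 = 1 + √3 := Real.sq_sqrt (by positivity)
  field_simp at hq
  have hq' : m = 2 - √3 * r := by linarith
  rw [hq'] at hm2
  have h2 : (2 * √3 + 1 - 3 * r) ^ 2 = (2 * √(1 + √3)) ^ 2 := by
    rw [mul_pow, h6]
    linear_combination 3 * hm2 + (4 - 3 * r ^ 2) * h3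
  have := (sq_eq_sq₀ (by linarith) (by positivity)).1 h2
  linarith

theorem eq_of_two_alpha_two_beta (hr : 0 < r)
    (h : 2 * cornerAngle r 1 1 + 2 * cornerAngle r 1 r = 2 * Real.pi) :
    r = (√17 - 3) / 4 := by
  obtain ⟨m, -, -, hc, -, -, hα⟩ := exists_angle_relations hr
  rw [show cornerAngle r 1 1 = Real.pi - cornerAngle r 1 r by linarith, Real.cos_pi_sub, hc] at hα
  field_simp at hα
  have h17 : √17 ^ 2 = 17 := Real.sq_sqrt (by norm_num)
  have h2 : (4 * r + 3) ^ 2 = √17 ^ 2 := by rw [h17]; linarith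
  have := (sq_eq_sq₀ (by linarith) (by positivity)).1 h2
  linarith

theorem root_of_two_alpha_two_beta' (hr : 0 < r)
    (h : 2 * cornerAngle r 1 1 + 2 * cornerAngle r 1 r + Real.pi / 3 = 2 * Real.pi) :
    (7 + 4 * √3) * r ^ 4 + (20 + 12 * √3) * r ^ 3 + (6 + 4 * √3) * r ^ 2
      + (-20 - 4 * √3) * r + 3 = 0 ∧ 0 < 2 * (1 + r) ^ 2 - 4 + √3 * r * (1 + r) := by
  obtain ⟨m, hm, hm2, hc, hs, -, hα⟩ := exists_angle_relations hr
  rw [show cornerAngle r 1 1 = Real.pi - (cornerAngle r 1 r + Real.pi / 6) by linarith,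
    Real.cos_pi_sub, Real.cos_add, hc, hs, Real.cos_pi_div_six, Real.sin_pi_div_six] at hα
  have h3 : √3 ^ 2 = 3 := Real.sq_sqrt (by norm_num)
  field_simp at hα
  have h1 : m * (1 + r) = 2 * (1 + r) ^ 2 - 4 + √3 * r * (1 + r) := by linarith
  refine ⟨?_, by rw [← h1]; positivity⟩
  have h2 : (m * (1 + r)) ^ 2 = (2 * (1 + r) ^ 2 - 4 + √3 * r * (1 + r)) ^ 2 := by rw [h1]
  linear_combination -h2 + (1 + r) ^ 2 * hm2 - (r * (1 + r)) ^ 2 * h3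

theorem root_of_three_alpha_two_beta (hr : 0 < r)
    (h : 3 * cornerAngle r 1 1 + 2 * cornerAngle r 1 r = 2 * Real.pi) :
    r ^ 4 - 10 * r ^ 2 - 8 * r + 9 = 0 := by
  obtain ⟨m, -, hm2, -, hs, hq, -⟩ := exists_angle_relations hr
  have h1 : Real.sin (3 * (cornerAngle r 1 1 / 2)) = Real.sin (cornerAngle r 1 r) := by
    rw [← Real.sin_pi_sub]
    congr 1
    linarith
  rw [Real.sin_three_mul, hq, hs] at h1
  have h2 : 3 * (1 + r) ^ 2 - 4 = m * (1 + r) ^ 2 := by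
    field_simp at h1
    linarith
  have h4 : r * (r ^ 4 - 10 * r ^ 2 - 8 * r + 9) = 0 := by
    have h3 : (3 * (1 + r) ^ 2 - 4) ^ 2 = (m * (1 + r) ^ 2) ^ 2 := by rw [h2]
    linear_combination (-1 / 2) * h3 - 1 / 2 * (1 + r) ^ 4 * hm2
  exact (mul_eq_zero.1 h4).resolve_left hr.ne'

theorem root_of_alpha_four_beta (hr : 0 < r)
    (h : cornerAngle r 1 1 + 4 * cornerAngle r 1 r = 2 * Real.pi) :
    8 * r ^ 3 + 3 * r ^ 2 - 2 * r - 1 = 0 := by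
  obtain ⟨m, -, hm2, hc, hs, hq, -⟩ := exists_angle_relations hr
  rw [show cornerAngle r 1 1 / 2 = Real.pi - 2 * cornerAngle r 1 r by linarith,
    Real.sin_pi_sub, Real.sin_two_mul, hc, hs] at hq
  field_simp at hq
  have h3 : (1 + r) ^ 2 = (2 * m * r) ^ 2 := by
    have : 1 + r = 2 * m * r := by linarith
    rw [this]
  linear_combination -h3 - 4 * r ^ 2 * hm2

theorem eq_of_four_beta (hr : 0 < r) (h : 4 * cornerAngle r 1 r + Real.pi / 3 = 2 * Real.pi) :
    r = Real.sin (Real.pi / 12) / (1 - Real.sin (Real.pi / 12)) := by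
  obtain ⟨m, -, -, hc, -, -, -⟩ := exists_angle_relations hr
  rw [show cornerAngle r 1 r = Real.pi / 2 - Real.pi / 12 by linarith,
    Real.cos_pi_div_two_sub] at hc
  rw [hc]
  field_simp
  ring

end Equations

/-! ### The table -/

theorem exists_root_first : ∃ x : ℝ, x ^ 4 - 10 * x ^ 2 - 8 * x + 9 = 0 ∧
    |x - 0.6375559772| < 1 / 10 ^ 10 := by
  have h := intermediate_value_Ioo' (a := 0.6375559772 - 1 / 10 ^ 10)
    (b := (0.6375559772 + 1 / 10 ^ 10 : ℝ)) (by norm_num)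
    (f := fun x : ℝ => x ^ 4 - 10 * x ^ 2 - 8 * x + 9) (by fun_prop)
  obtain ⟨x, ⟨h1, h2⟩, hx⟩ := h (show (0 : ℝ) ∈ Set.Ioo _ _ from ⟨by norm_num, by norm_num⟩)
  exact ⟨x, hx, by rw [abs_lt]; constructor <;> linarith⟩

theorem exists_root_second : ∃ x : ℝ, (7 + 4 * √3) * x ^ 4 + (20 + 12 * √3) * x ^ 3
      + (6 + 4 * √3) * x ^ 2 + (-20 - 4 * √3) * x + 3 = 0 ∧
    |x - 0.5451510421| < 1 / 10 ^ 10 := by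
  have hl : (1.73205080756887 : ℝ) < √3 := by rw [Real.lt_sqrt] <;> norm_num
  have hu : √3 < 1.73205080756888 := by rw [Real.sqrt_lt'] <;> norm_num
  have h := intermediate_value_Ioo (a := 0.5451510421 - 1 / 10 ^ 10)
    (b := (0.5451510421 + 1 / 10 ^ 10 : ℝ)) (by norm_num)
    (f := fun x : ℝ => (7 + 4 * √3) * x ^ 4 + (20 + 12 * √3) * x ^ 3
      + (6 + 4 * √3) * x ^ 2 + (-20 - 4 * √3) * x + 3) (by fun_prop)
  obtain ⟨x, ⟨h1, h2⟩, hx⟩ := h (show (0 : ℝ) ∈ Set.Ioo _ _ from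
    ⟨by norm_num; linarith, by norm_num; linarith⟩)
  exact ⟨x, hx, by rw [abs_lt]; constructor <;> linarith⟩

theorem exists_root_third : ∃ x : ℝ, 8 * x ^ 3 + 3 * x ^ 2 - 2 * x - 1 = 0 ∧
    |x - 0.5332964167| < 1 / 10 ^ 10 := by
  have h := intermediate_value_Ioo (a := 0.5332964167 - 1 / 10 ^ 10)
    (b := (0.5332964167 + 1 / 10 ^ 10 : ℝ)) (by norm_num)
    (f := fun x : ℝ => 8 * x ^ 3 + 3 * x ^ 2 - 2 * x - 1) (by fun_prop)
  obtain ⟨x, ⟨h1, h2⟩, hx⟩ := h (show (0 : ℝ) ∈ Set.Ioo _ _ from ⟨by norm_num, by norm_num⟩)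
  exact ⟨x, hx, by rw [abs_lt]; constructor <;> linarith⟩

theorem root_first_unique {x y : ℝ} (hx0 : 0 < x) (hy0 : 0 < y) (hx1 : x < 1) (hy1 : y < 1)
    (hx : x ^ 4 - 10 * x ^ 2 - 8 * x + 9 = 0) (hy : y ^ 4 - 10 * y ^ 2 - 8 * y + 9 = 0) :
    x = y := by
  have h : (x - y) * ((x + y) * (10 - (x ^ 2 + y ^ 2)) + 8) = 0 := by
    linear_combination hy - hx
  refine sub_eq_zero.1 ((mul_eq_zero.1 h).resolve_right (ne_of_gt ?_))
  have : 0 < 10 - (x ^ 2 + y ^ 2) := by nlinarith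
  positivity

/-- The quartic is convex on the positive half-line and negative at `0.29`, below which the
additional inequality fails. So it has a single root beyond this point. -/
theorem root_second_unique {x y : ℝ} (hx0 : 0 < x) (hy0 : 0 < y)
    (hx : (7 + 4 * √3) * x ^ 4 + (20 + 12 * √3) * x ^ 3 + (6 + 4 * √3) * x ^ 2
      + (-20 - 4 * √3) * x + 3 = 0) (hx' : 0 < 2 * (1 + x) ^ 2 - 4 + √3 * x * (1 + x))
    (hy : (7 + 4 * √3) * y ^ 4 + (20 + 12 * √3) * y ^ 3 + (6 + 4 * √3) * y ^ 2
      + (-20 - 4 * √3) * y + 3 = 0) (hy' : 0 < 2 * (1 + y) ^ 2 - 4 + √3 * y * (1 + y)) :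
    x = y := by
  have hl : (1.73 : ℝ) < √3 := by rw [Real.lt_sqrt] <;> norm_num
  have hu : √3 < 1.74 := by rw [Real.sqrt_lt'] <;> norm_num
  have key : ∀ z : ℝ, 0 < z → 0 < 2 * (1 + z) ^ 2 - 4 + √3 * z * (1 + z) → 0.29 < z := by
    intro z hz h
    by_contra! hcon
    have h1 : √3 * z * (1 + z) ≤ 1.74 * 0.29 * (1 + 0.29) := by gcongr
    nlinarith
  have hx2 := key x hx0 hx'
  have hy2 := key y hy0 hy'
  have h : (x - y) * ((7 + 4 * √3) * (x ^ 3 + x ^ 2 * y + x * y ^ 2 + y ^ 3)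
      + (20 + 12 * √3) * (x ^ 2 + x * y + y ^ 2) + (6 + 4 * √3) * (x + y)
      - (20 + 4 * √3)) = 0 := by
    linear_combination hx - hy
  refine sub_eq_zero.1 ((mul_eq_zero.1 h).resolve_right (ne_of_gt ?_))
  -- The divided difference at `x`, `y` is at least the one at `x`, `0.29`.
  have h1 : 0 < (x - 0.29) * ((7 + 4 * √3) * (x ^ 3 + x ^ 2 * 0.29 + x * 0.29 ^ 2 + 0.29 ^ 3)
      + (20 + 12 * √3) * (x ^ 2 + x * 0.29 + 0.29 ^ 2) + (6 + 4 * √3) * (x + 0.29)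
      - (20 + 4 * √3)) := by
    have : (7 + 4 * √3) * 0.29 ^ 4 + (20 + 12 * √3) * 0.29 ^ 3 + (6 + 4 * √3) * 0.29 ^ 2
      + (-20 - 4 * √3) * 0.29 + 3 < 0 := by norm_num; linarith
    linarith
  refine (pos_of_mul_pos_right h1 (by linarith)).trans_le ?_
  gcongr

theorem root_third_unique {x y : ℝ} (hx0 : 0 < x) (hy0 : 0 < y)
    (hx : 8 * x ^ 3 + 3 * x ^ 2 - 2 * x - 1 = 0) (hy : 8 * y ^ 3 + 3 * y ^ 2 - 2 * y - 1 = 0) :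
    x = y := by
  have h : (x - y) * (8 * x * y * (x + y) + 3 * x * y + 1) = 0 := by
    linear_combination y * hx - x * hy
  refine sub_eq_zero.1 ((mul_eq_zero.1 h).resolve_right (ne_of_gt ?_))
  positivity

theorem sin_pi_div_twelve : Real.sin (Real.pi / 12) = (√6 - √2) / 4 := by
  rw [show Real.pi / 12 = Real.pi / 3 - Real.pi / 4 by ring, Real.sin_sub,
    Real.sin_pi_div_three, Real.cos_pi_div_three, Real.sin_pi_div_four, Real.cos_pi_div_four,
    show (6 : ℝ) = 3 * 2 by norm_num, Real.sqrt_mul (by norm_num)]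
  ring

theorem abs_sin_div_sub_lt :
    |Real.sin (Real.pi / 12) / (1 - Real.sin (Real.pi / 12)) - 0.3491981862| < 1 / 10 ^ 10 := by
  have h6l : (2.449489742783 : ℝ) < √6 := by rw [Real.lt_sqrt] <;> norm_num
  have h6u : √6 < 2.449489742784 := by rw [Real.sqrt_lt'] <;> norm_num
  have h2l : (1.414213562373 : ℝ) < √2 := by rw [Real.lt_sqrt] <;> norm_num
  have h2u : √2 < 1.414213562374 := by rw [Real.sqrt_lt'] <;> norm_num
  rw [sin_pi_div_twelve, abs_lt]
  have h : 0 < 1 - (√6 - √2) / 4 := by linarith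
  constructor
  · rw [lt_sub_iff_add_lt, lt_div_iff₀ h]
    norm_num
    linarith
  · rw [sub_lt_iff_lt_add, div_lt_iff₀ h]
    norm_num
    linarith

theorem isTable_of_roots {x y z : ℝ} (hx : x ^ 4 - 10 * x ^ 2 - 8 * x + 9 = 0)
    (hx' : |x - 0.6375559772| < 1 / 10 ^ 10)
    (hy : (7 + 4 * √3) * y ^ 4 + (20 + 12 * √3) * y ^ 3 + (6 + 4 * √3) * y ^ 2
      + (-20 - 4 * √3) * y + 3 = 0) (hy' : |y - 0.5451510421| < 1 / 10 ^ 10)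
    (hz : 8 * z ^ 3 + 3 * z ^ 2 - 2 * z - 1 = 0) (hz' : |z - 0.5332964167| < 1 / 10 ^ 10) :
    IsTable ![x, y, z, √2 - 1, (2 * √3 + 1 - 2 * √(1 + √3)) / 3,
      Real.sin (Real.pi / 12) / (1 - Real.sin (Real.pi / 12)), (√17 - 3) / 4, 2 * √3 / 3 - 1,
      5 - 2 * √6] where
  exact1 := hx
  exact2 := hy
  exact3 := hz
  exact4 := rfl
  exact5 := rfl
  exact6 := rfl
  exact7 := rfl
  exact8 := rfl
  exact9 := rfl
  decimal1 := hx'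
  decimal2 := hy'
  decimal3 := hz'
  decimal4 := by
    have h2l : (1.414213562373 : ℝ) < √2 := by rw [Real.lt_sqrt] <;> norm_num
    have h2u : √2 < 1.414213562374 := by rw [Real.sqrt_lt'] <;> norm_num
    show |√2 - 1 - 0.4142135624| < _
    rw [abs_lt]; constructor <;> linarith
  decimal5 := by
    have hl : (1.732050807568 : ℝ) < √3 := by rw [Real.lt_sqrt] <;> norm_num
    have hu : √3 < 1.732050807569 := by rw [Real.sqrt_lt'] <;> norm_num
    have hl' : (1.652891650200 : ℝ) < √(1 + √3) := by
      rw [Real.lt_sqrt (by norm_num)]; norm_num; linarith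
    have hu' : √(1 + √3) < 1.652891650282 := by
      rw [Real.sqrt_lt' (by norm_num)]; norm_num; linarith
    show |(2 * √3 + 1 - 2 * √(1 + √3)) / 3 - 0.3861061049| < _
    rw [abs_lt]; constructor <;> linarith
  decimal6 := abs_sin_div_sub_lt
  decimal7 := by
    have hl : (4.123105625617 : ℝ) < √17 := by rw [Real.lt_sqrt] <;> norm_num
    have hu : √17 < 4.123105625618 := by rw [Real.sqrt_lt'] <;> norm_num
    show |(√17 - 3) / 4 - 0.2807764064| < _
    rw [abs_lt]; constructor <;> linarith
  decimal8 := by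
    have hl : (1.732050807568 : ℝ) < √3 := by rw [Real.lt_sqrt] <;> norm_num
    have hu : √3 < 1.732050807569 := by rw [Real.sqrt_lt'] <;> norm_num
    show |2 * √3 / 3 - 1 - 0.1547005384| < _
    rw [abs_lt]; constructor <;> linarith
  decimal9 := by
    have h6l : (2.449489742783 : ℝ) < √6 := by rw [Real.lt_sqrt] <;> norm_num
    have h6u : √6 < 2.449489742784 := by rw [Real.sqrt_lt'] <;> norm_num
    show |5 - 2 * √6 - 0.1010205144| < _
    rw [abs_lt]; constructor <;> linarith

/-- The table is decreasing. -/
theorem IsTable.strictAnti {c : Fin 9 → ℝ} (h : IsTable c) : StrictAnti c := by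
  obtain ⟨-, -, -, -, -, -, -, -, -, h1, h2, h3, h4, h5, h6, h7, h8, h9⟩ := h
  rw [abs_lt] at h1 h2 h3 h4 h5 h6 h7 h8 h9
  norm_num at h1 h2 h3 h4 h5 h6 h7 h8 h9
  rw [Fin.strictAnti_iff_succ_lt]
  intro i
  fin_cases i <;> simp <;> linarith

/-! ### One full turn -/

theorem eq_of_coe_angle_eq {x y : ℝ} (h : (x : Real.Angle) = y) (h1 : x - y < 2 * Real.pi)
    (h2 : -(2 * Real.pi) < x - y) : x = y := by
  obtain ⟨k, hk⟩ := Real.Angle.angle_eq_iff_two_pi_dvd_sub.1 h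
  have hpi := Real.pi_pos
  rw [hk] at h1 h2
  have hk1 : (k : ℝ) < 1 := by nlinarith
  have hk2 : (-1 : ℝ) < k := by nlinarith
  have hk0 : k = 0 := by
    have : k < 1 := by exact_mod_cast hk1
    have : -1 < k := by exact_mod_cast hk2
    omega
  rw [hk0] at hk
  simp at hk
  linarith

theorem arg_pos_of_im_pos {z : ℂ} (h : 0 < z.im) : 0 < z.arg := by
  refine lt_of_le_of_ne (Complex.arg_nonneg_iff.2 h.le) fun h0 => ?_
  exact h.ne' (Complex.arg_eq_zero_iff.1 h0.symm).2

theorem arg_lt_pi_of_im_pos {z : ℂ} (h : 0 < z.im) : z.arg < Real.pi := by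
  refine lt_of_le_of_ne (Complex.arg_le_pi z) fun h0 => ?_
  exact h.ne' (Complex.arg_eq_pi_iff.1 h0).2

/-- A closed sequence of directions that always turns counterclockwise, and that passes only once
from the left to the right side of a line, makes exactly one full turn. -/
theorem sum_arg_div_eq_two_pi {d : ℕ → ℂ} {n k : ℕ} (hk : 0 < k) (hkn : k < n)
    (hclosed : d n = d 0) (hturn : ∀ t < n, 0 < (d (t + 1) / d t).arg)
    (hleft : ∀ t < k, 0 < (d t).im) (hright : ∀ t, k ≤ t → t < n → (d t).im < 0) :
    ∑ t ∈ Finset.range n, (d (t + 1) / d t).arg = 2 * Real.pi := by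
  have hpi := Real.pi_pos
  let f : ℕ → ℝ := fun t => (d t).arg + if k ≤ t then 2 * Real.pi else 0
  have hne : ∀ t ≤ n, d t ≠ 0 := by
    intro t ht h0
    rcases lt_or_ge t k with h | h
    · have := hleft t h; simp [h0] at this
    · rcases ht.lt_or_eq with h1 | rfl
      · have := hright t h h1; simp [h0] at this
      · have := hleft 0 hk; rw [← hclosed, h0] at this; simp at this
  have hstep : ∀ t ∈ Finset.range n, (d (t + 1) / d t).arg = f (t + 1) - f t := by
    intro t ht
    have ht := Finset.mem_range.1 ht
    have h1 := hturn t ht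
    have h2 := Complex.arg_le_pi (d (t + 1) / d t)
    have hl : ∀ s < k, 0 < (d s).arg ∧ (d s).arg < Real.pi := fun s hs =>
      ⟨arg_pos_of_im_pos (hleft s hs), arg_lt_pi_of_im_pos (hleft s hs)⟩
    have hr : ∀ s, k ≤ s → s < n → (d s).arg < 0 ∧ -Real.pi < (d s).arg := fun s hs hs' =>
      ⟨Complex.arg_neg_iff.2 (hright s hs hs'), Complex.neg_pi_lt_arg _⟩
    have hcoe : ((d (t + 1) / d t).arg : Real.Angle) = ((f (t + 1) - f t : ℝ) : Real.Angle) := by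
      rw [Complex.arg_div_coe_angle (hne _ ht) (hne _ ht.le)]
      simp only [f]
      split_ifs <;> simp
    have hlast : t + 1 = n → 0 < (d (t + 1)).arg ∧ (d (t + 1)).arg < Real.pi := by
      intro h; rw [h, hclosed]; exact hl 0 hk
    refine eq_of_coe_angle_eq hcoe ?_ ?_ <;> simp only [f]
    all_goals
      rcases lt_or_ge t k with h3 | h3 <;> rcases lt_or_ge (t + 1) k with h4 | h4
      · rw [if_neg (by omega), if_neg (by omega)]
        linarith [hl t h3, hl (t + 1) h4]
      · rw [if_pos h4, if_neg (by omega)]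
        have h5 := hr (t + 1) h4 (by omega)
        linarith [hl t h3]
      · omega
      · rw [if_pos h3, if_pos h4]
        have h5 := hr t h3 ht
        rcases (show t + 1 ≤ n from ht).lt_or_eq with h6 | h6
        · have h7 := hr (t + 1) h4 h6
          linarith
        · have h7 := hlast h6
          linarith
  rw [Finset.sum_congr rfl hstep, Finset.sum_range_sub]
  simp only [f, hclosed]
  rw [if_pos hkn.le, if_neg (by omega)]
  ring

/-! ### Periodic families of discs -/

/-- A family of discs that is invariant under the translations of a lattice. The vectors
`(ux, uy)` and `(wx, wy)` generate the lattice, and there are `k` orbits of discs, with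
representatives of center `(x i, y i)` and radius `ρ i`. -/
structure PeriodicFamily (k : ℕ) where
  (ux uy wx wy : ℝ)
  (x y ρ : Fin k → ℝ)
  ρ_pos : ∀ i, 0 < ρ i

/-- `(j, m, n)` labels the translate of the `j`-th disc by `m` times the first and `n` times the
second generator of the lattice. -/
abbrev Label (k : ℕ) := Fin k × ℤ × ℤ

/-- The label of the disc `b` after the translation that takes the disc `a` to the representative of
its orbit. -/
def Label.rel {k : ℕ} (a b : Label k) : Label k := (b.1, b.2.1 - a.2.1, b.2.2 - a.2.2)

/-- The label of the disc `b` after the translation that takes the representative of the orbit of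
`a` to the disc `a`. -/
def Label.translate {k : ℕ} (a b : Label k) : Label k := (b.1, b.2.1 + a.2.1, b.2.2 + a.2.2)

theorem Label.rel_translate {k : ℕ} (a l : Label k) : a.rel (a.translate l) = l := by
  simp [Label.rel, Label.translate]

theorem Label.translate_rel_translate {k : ℕ} (a l l' : Label k) :
    (a.translate l).rel (a.translate l') = l.rel l' := by
  simp [Label.rel, Label.translate]

namespace PeriodicFamily

variable {k : ℕ} (Q : PeriodicFamily k)

/-- The disc of a label. -/
noncomputable def disc (l : Label k) : Disc where
  center := ⟨Q.x l.1 + l.2.1 * Q.ux + l.2.2 * Q.wx, Q.y l.1 + l.2.1 * Q.uy + l.2.2 * Q.wy⟩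
  radius := Q.ρ l.1
  radius_pos := Q.ρ_pos l.1

/-- First coordinate of the vector from the `i`-th representative to the disc `l`. -/
def dx (i : Fin k) (l : Label k) : ℝ := Q.x l.1 + l.2.1 * Q.ux + l.2.2 * Q.wx - Q.x i

/-- Second coordinate of the vector from the `i`-th representative to the disc `l`. -/
def dy (i : Fin k) (l : Label k) : ℝ := Q.y l.1 + l.2.1 * Q.uy + l.2.2 * Q.wy - Q.y i

/-- The tangency of the `i`-th representative and the disc `l`, in coordinates. -/
def Touches (i : Fin k) (l : Label k) : Prop :=
  Q.dx i l ^ 2 + Q.dy i l ^ 2 = (Q.ρ i + Q.ρ l.1) ^ 2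

theorem center_sub (a b : Label k) :
    (Q.disc b).center - (Q.disc a).center = ⟨Q.dx a.1 (a.rel b), Q.dy a.1 (a.rel b)⟩ := by
  apply Complex.ext <;> simp [disc, dx, dy, Label.rel] <;> ring

theorem sq_dist_disc (a b : Label k) :
    dist (Q.disc a).center (Q.disc b).center ^ 2
      = Q.dx a.1 (a.rel b) ^ 2 + Q.dy a.1 (a.rel b) ^ 2 := by
  rw [dist_comm, dist_eq_norm, Complex.sq_norm, center_sub, Complex.normSq_mk]
  ring

theorem tangent_disc_iff (a b : Label k) :
    (Q.disc a).Tangent (Q.disc b) ↔ Q.Touches a.1 (a.rel b) := by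
  unfold Disc.Tangent Touches
  rw [← sq_dist_disc, sq_eq_sq₀ dist_nonneg
    (add_nonneg (Q.ρ_pos _).le (Q.ρ_pos _).le)]
  rfl

theorem touches_swap {i : Fin k} {l : Label k} (h : Q.Touches l.1 (l.rel (i, 0, 0))) :
    Q.Touches i l := by
  have h1 := (Q.tangent_disc_iff l (i, 0, 0)).2 h
  have h2 : (Q.disc (i, 0, 0)).Tangent (Q.disc l) := by
    unfold Disc.Tangent at h1 ⊢
    rw [dist_comm, h1, add_comm]
  have h3 := (Q.tangent_disc_iff _ _).1 h2
  simpa [Label.rel] using h3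

end PeriodicFamily

/-! ### Certificates with integer coordinates -/

theorem abs_cross_sub_le {x y x' y' X Y X' Y' e : ℝ} (hx : |x - X| ≤ e) (hy : |y - Y| ≤ e)
    (hx' : |x' - X'| ≤ e) (hy' : |y' - Y'| ≤ e) :
    |x * y' - y * x' - (X * Y' - Y * X')| ≤ e * (|X| + |Y| + |X'| + |Y'|) + 2 * e ^ 2 := by
  have he : 0 ≤ e := (abs_nonneg _).trans hx
  have h : x * y' - y * x' - (X * Y' - Y * X') = (x - X) * (y' - Y') - (y - Y) * (x' - X')
      + X * (y' - Y') + (x - X) * Y' - Y * (x' - X') - (y - Y) * X' := by ring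
  have m : ∀ {a b c d : ℝ}, |a| ≤ c → |b| ≤ d → 0 ≤ c → |a * b| ≤ c * d := by
    intro a b c d h1 h2 h3
    rw [abs_mul]
    exact mul_le_mul h1 h2 (abs_nonneg _) h3
  have h1 := abs_le.1 (m hx hy' he)
  have h2 := abs_le.1 (m hy hx' he)
  have h3 := abs_le.1 (m (le_refl |X|) hy' (abs_nonneg _))
  have h4 := abs_le.1 (m hx (le_refl |Y'|) he)
  have h5 := abs_le.1 (m (le_refl |Y|) hx' (abs_nonneg _))
  have h6 := abs_le.1 (m hy (le_refl |X'|) he)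
  rw [h, abs_le]
  constructor <;> nlinarith

/-- Integers that approximate the data of a `PeriodicFamily`, in units of `10 ^ (-5)`, so that all
inequalities between strictly separated quantities become decidable. -/
structure IntData (k : ℕ) where
  (ux uy wx wy : ℤ)
  (x y : Fin k → ℤ)
  ρ : Fin k → ℕ

namespace IntData

variable {k : ℕ} (A : IntData k)

/-- The approximation of `PeriodicFamily.dx`. -/
def dx (i : Fin k) (l : Label k) : ℤ := A.x l.1 + l.2.1 * A.ux + l.2.2 * A.wx - A.x i

/-- The approximation of `PeriodicFamily.dy`. -/
def dy (i : Fin k) (l : Label k) : ℤ := A.y l.1 + l.2.1 * A.uy + l.2.2 * A.wy - A.y i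

/-- The labels for which `12` bounds the error of the approximate coordinate differences. -/
def Near (l : Label k) : Prop := l.2.1.natAbs + l.2.2.natAbs ≤ 10

/-- The discs `i` and `l` are disjoint, whatever the errors of the approximation are. The truncated
subtractions bound the absolute values of the exact coordinate differences from below. -/
def Far (i : Fin k) (l : Label k) : Prop :=
  (A.ρ i + A.ρ l.1 + 2) ^ 2 ≤ ((A.dx i l).natAbs - 12) ^ 2 + ((A.dy i l).natAbs - 12) ^ 2

/-- A bound for the error of the cross product of two approximate vectors. -/
def crossError (X Y X' Y' : ℤ) : ℤ :=
  12 * (X.natAbs + Y.natAbs + X'.natAbs + Y'.natAbs : ℕ) + 288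

/-- Seen from the disc `i`, the turn from `l` to `l'` is counterclockwise. -/
def Turns (i : Fin k) (l l' : Label k) : Prop :=
  crossError (A.dx i l) (A.dy i l) (A.dx i l') (A.dy i l')
    < A.dx i l * A.dy i l' - A.dy i l * A.dx i l'

/-- Let `(X, Y)` be the vector from one representative to another. Then its sum with `m` times the
first and `n` times the second generator has length at least `2` whenever `|m|` is at least `3`,
because its distance from the line spanned by the second generator is large. -/
def FarRows (ux uy wx wy : ℤ) (X Y : ℤ) : Prop :=
  0 ≤ 3 * (ux * wy - uy * wx - crossError ux uy wx wy) - (X * wy - Y * wx).natAbs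
      - crossError X Y wx wy ∧
    200000 ^ 2 * ((wx.natAbs + 12) ^ 2 + (wy.natAbs + 12) ^ 2 : ℕ)
      ≤ (3 * (ux * wy - uy * wx - crossError ux uy wx wy) - (X * wy - Y * wx).natAbs
        - crossError X Y wx wy) ^ 2

/-- One of the two tangencies `(i, l)` and `(l, i)`, up to translation, is listed in `T`. -/
def Listed (T : List (Fin k × Label k)) (i : Fin k) (l : Label k) : Prop :=
  (i, l) ∈ T ∨ (l.1, l.rel (i, 0, 0)) ∈ T

/-- The list `L` is a ring of discs around the disc `i`. Its first `h` discs are to the left of the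
directed line with the generic direction `(1000, 137)` through the center of the disc `i`, and the
others are to the right of it. -/
def RingCheck (T : List (Fin k × Label k)) (i : Fin k) (h : ℕ) (L : List (Label k)) : Prop :=
  0 < h ∧ h < L.length ∧ ∀ t < L.length,
    Near (L.getD t (i, 0, 0)) ∧
    Listed T i (L.getD t (i, 0, 0)) ∧
    Listed T (L.getD t (i, 0, 0)).1
      ((L.getD t (i, 0, 0)).rel (L.getD ((t + 1) % L.length) (i, 0, 0))) ∧
    A.Turns i (L.getD t (i, 0, 0)) (L.getD ((t + 1) % L.length) (i, 0, 0)) ∧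
    if t < h then
      12 * 1137 < 1000 * A.dy i (L.getD t (i, 0, 0)) - 137 * A.dx i (L.getD t (i, 0, 0))
    else 1000 * A.dy i (L.getD t (i, 0, 0)) - 137 * A.dx i (L.getD t (i, 0, 0)) < -(12 * 1137)

/-- The discs `i` and `(j, m, n)` with `|m|, |n| ≤ 2` are equal, tangent or disjoint. -/
def SeparationCheck (T : List (Fin k × Label k)) : Prop :=
  ∀ i j : Fin k, ∀ a < 5, ∀ b < 5,
    A.Far i (j, ((a : ℕ) : ℤ) - 2, ((b : ℕ) : ℤ) - 2) ∨
    ((j, (a : ℤ) - 2, (b : ℤ) - 2) : Label k) = (i, 0, 0) ∨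
    Listed T i (j, (a : ℤ) - 2, (b : ℤ) - 2)

/-- The certificate of a compact packing: `T` lists tangencies, and `L` a ring around each
representative, together with the number of its discs to the left of the line in `RingCheck`. -/
def Certificate (T : List (Fin k × Label k)) (L : Fin k → ℕ × List (Label k)) : Prop :=
  A.SeparationCheck T ∧ (∀ i, A.RingCheck T i (L i).1 (L i).2) ∧
  (∀ i j : Fin k, FarRows A.ux A.uy A.wx A.wy (A.x j - A.x i) (A.y j - A.y i)) ∧
  ∀ i j : Fin k, FarRows A.wx A.wy (-A.ux) (-A.uy) (A.x j - A.x i) (A.y j - A.y i)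

instance (l : Label k) : Decidable (Near l) := inferInstanceAs (Decidable (_ ≤ _))

instance (i : Fin k) (l : Label k) : Decidable (A.Far i l) := inferInstanceAs (Decidable (_ ≤ _))

instance (i : Fin k) (l l' : Label k) : Decidable (A.Turns i l l') :=
  inferInstanceAs (Decidable (_ < _))

instance (a b c d e f : ℤ) : Decidable (FarRows a b c d e f) :=
  inferInstanceAs (Decidable (_ ∧ _))

instance (T : List (Fin k × Label k)) (i : Fin k) (l : Label k) : Decidable (Listed T i l) :=
  inferInstanceAs (Decidable (_ ∨ _))

instance (T : List (Fin k × Label k)) (i : Fin k) (h : ℕ) (L : List (Label k)) :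
    Decidable (A.RingCheck T i h L) :=
  inferInstanceAs (Decidable (_ ∧ _ ∧ ∀ t < L.length, _))

instance (T : List (Fin k × Label k)) : Decidable (A.SeparationCheck T) :=
  by unfold SeparationCheck; infer_instance

instance (T : List (Fin k × Label k)) (L : Fin k → ℕ × List (Label k)) :
    Decidable (A.Certificate T L) :=
  inferInstanceAs (Decidable (_ ∧ _ ∧ _ ∧ _))

end IntData

/-- The integers `A` approximate the data of `Q`. -/
structure IntData.Approximates {k : ℕ} (A : IntData k) (Q : PeriodicFamily k) : Prop where
  ux : |100000 * Q.ux - A.ux| ≤ 1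
  uy : |100000 * Q.uy - A.uy| ≤ 1
  wx : |100000 * Q.wx - A.wx| ≤ 1
  wy : |100000 * Q.wy - A.wy| ≤ 1
  x : ∀ i, |100000 * Q.x i - A.x i| ≤ 1
  y : ∀ i, |100000 * Q.y i - A.y i| ≤ 1
  ρ : ∀ i, |100000 * Q.ρ i - A.ρ i| ≤ 1

namespace IntData

variable {k : ℕ} {A : IntData k} {Q : PeriodicFamily k}

theorem abs_difference_sub_le {p q u w : ℝ} {P P' U W m n : ℤ} (hp : |100000 * p - P| ≤ 1)
    (hq : |100000 * q - P'| ≤ 1) (hu : |100000 * u - U| ≤ 1) (hw : |100000 * w - W| ≤ 1)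
    (h : m.natAbs + n.natAbs ≤ 10) :
    |100000 * (p + m * u + n * w - q) - ((P + m * U + n * W - P' : ℤ) : ℝ)| ≤ 12 := by
  have hm : |(m : ℝ) * (100000 * u - U)| ≤ |(m : ℝ)| := by
    rw [abs_mul]; exact mul_le_of_le_one_right (abs_nonneg _) hu
  have hn : |(n : ℝ) * (100000 * w - W)| ≤ |(n : ℝ)| := by
    rw [abs_mul]; exact mul_le_of_le_one_right (abs_nonneg _) hw
  have h' : |(m : ℝ)| + |(n : ℝ)| ≤ 10 := by
    have : ((m.natAbs + n.natAbs : ℕ) : ℝ) ≤ 10 := by exact_mod_cast h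
    rwa [Nat.cast_add, Nat.cast_natAbs, Nat.cast_natAbs, Int.cast_abs, Int.cast_abs] at this
  push_cast
  rw [abs_le] at *
  constructor <;> linarith

theorem Approximates.dx_sub_le (h : A.Approximates Q) {i : Fin k} {l : Label k} (hl : Near l) :
    |100000 * Q.dx i l - A.dx i l| ≤ 12 :=
  abs_difference_sub_le (h.x _) (h.x _) h.ux h.wx hl

theorem Approximates.dy_sub_le (h : A.Approximates Q) {i : Fin k} {l : Label k} (hl : Near l) :
    |100000 * Q.dy i l - A.dy i l| ≤ 12 :=
  abs_difference_sub_le (h.y _) (h.y _) h.uy h.wy hl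

theorem natAbs_sub_le {x : ℝ} {X : ℤ} (h : |100000 * x - X| ≤ 12) :
    ((X.natAbs - 12 : ℕ) : ℝ) ≤ 100000 * |x| := by
  rcases le_total X.natAbs 12 with h1 | h1
  · rw [Nat.sub_eq_zero_of_le h1]; push_cast; positivity
  · rw [Nat.cast_sub h1, Nat.cast_natAbs, Int.cast_abs]
    have h2 := abs_sub_abs_le_abs_sub (X : ℝ) (100000 * x)
    rw [abs_sub_comm, abs_mul, abs_of_pos (by norm_num : (0 : ℝ) < 100000)] at h2
    push_cast
    linarith

theorem Far.le (hA : A.Approximates Q) {i : Fin k} {l : Label k} (hl : Near l) (h : A.Far i l) :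
    (Q.ρ i + Q.ρ l.1) ^ 2 ≤ Q.dx i l ^ 2 + Q.dy i l ^ 2 := by
  have h1 := natAbs_sub_le (hA.dx_sub_le (i := i) hl)
  have h2 := natAbs_sub_le (hA.dy_sub_le (i := i) hl)
  have h3 : ((A.ρ i + A.ρ l.1 + 2 : ℕ) : ℝ) ^ 2 ≤ (((A.dx i l).natAbs - 12 : ℕ) : ℝ) ^ 2
      + (((A.dy i l).natAbs - 12 : ℕ) : ℝ) ^ 2 := by exact_mod_cast h
  have h4 := pow_le_pow_left₀ (Nat.cast_nonneg _) h1 2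
  have h5 := pow_le_pow_left₀ (Nat.cast_nonneg _) h2 2
  rw [mul_pow, sq_abs] at h4 h5
  have h6 : 100000 * (Q.ρ i + Q.ρ l.1) ≤ ((A.ρ i + A.ρ l.1 + 2 : ℕ) : ℝ) := by
    have := abs_le.1 (hA.ρ i)
    have := abs_le.1 (hA.ρ l.1)
    push_cast
    linarith
  have h7 := pow_le_pow_left₀ (by have := Q.ρ_pos i; have := Q.ρ_pos l.1; positivity) h6 2
  rw [mul_pow] at h7
  linarith

theorem cast_crossError (X Y X' Y' : ℤ) :
    ((crossError X Y X' Y' : ℤ) : ℝ) = 12 * (|(X : ℝ)| + |(Y : ℝ)| + |(X' : ℝ)| + |(Y' : ℝ)|)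
      + 2 * 12 ^ 2 := by
  unfold crossError
  push_cast [Nat.cast_natAbs]
  ring

theorem Turns.cross_pos (hA : A.Approximates Q) {i : Fin k} {l l' : Label k} (hl : Near l)
    (hl' : Near l') (h : A.Turns i l l') : 0 < Q.dx i l * Q.dy i l' - Q.dy i l * Q.dx i l' := by
  have h1 := abs_cross_sub_le (hA.dx_sub_le (i := i) hl) (hA.dy_sub_le (i := i) hl)
    (hA.dx_sub_le (i := i) hl') (hA.dy_sub_le (i := i) hl')
  have h2 : ((crossError (A.dx i l) (A.dy i l) (A.dx i l') (A.dy i l') : ℤ) : ℝ)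
      < ((A.dx i l * A.dy i l' - A.dy i l * A.dx i l' : ℤ) : ℝ) := by exact_mod_cast h
  rw [cast_crossError] at h2
  push_cast at h2
  have h3 := (abs_le.1 h1).1
  linarith

theorem FarRows.four_le {ux uy wx wy X Y m n : ℤ} {u u' w w' x y : ℝ}
    (h : FarRows ux uy wx wy X Y) (hu : |100000 * u - ux| ≤ 12) (hu' : |100000 * u' - uy| ≤ 12)
    (hw : |100000 * w - wx| ≤ 12) (hw' : |100000 * w' - wy| ≤ 12) (hx : |100000 * x - X| ≤ 12)
    (hy : |100000 * y - Y| ≤ 12) (hm : 3 ≤ m.natAbs) :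
    2 ^ 2 ≤ (x + m * u + n * w) ^ 2 + (y + m * u' + n * w') ^ 2 := by
  obtain ⟨h1, h2⟩ := h
  have c1 := abs_cross_sub_le hu hu' hw hw'
  have c2 := abs_cross_sub_le hx hy hw hw'
  rw [← cast_crossError] at c1 c2
  set B : ℤ := 3 * (ux * wy - uy * wx - crossError ux uy wx wy) - (X * wy - Y * wx).natAbs
    - crossError X Y wx wy with hB
  have hBr : (B : ℝ) = 3 * ((ux * wy - uy * wx : ℝ) - (crossError ux uy wx wy : ℤ))
      - |(X * wy - Y * wx : ℝ)| - (crossError X Y wx wy : ℤ) := by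
    rw [hB]; push_cast [Nat.cast_natAbs]; ring
  have hm' : (3 : ℝ) ≤ |(m : ℝ)| := by
    rw [← Int.cast_abs, ← Nat.cast_natAbs]; exact_mod_cast hm
  have hB0 : (0 : ℝ) ≤ B := by exact_mod_cast h1
  set v := x + m * u + n * w with hv
  set v' := y + m * u' + n * w' with hv'
  have hcross : v * w' - v' * w = m * (u * w' - u' * w) + (x * w' - y * w) := by
    rw [hv, hv']; ring
  have hlow : (B : ℝ) ≤ 100000 ^ 2 * |v * w' - v' * w| := by
    rw [hcross]
    have e1 : ((ux * wy - uy * wx : ℝ) - (crossError ux uy wx wy : ℤ))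
        ≤ 100000 ^ 2 * (u * w' - u' * w) := by
      have := (abs_le.1 c1).1
      linarith
    have e2 : 100000 ^ 2 * |x * w' - y * w| ≤ |(X * wy - Y * wx : ℝ)|
        + (crossError X Y wx wy : ℤ) := by
      have e3 := abs_sub_abs_le_abs_sub (100000 * x * (100000 * w') - 100000 * y * (100000 * w))
        (X * wy - Y * wx : ℝ)
      rw [show 100000 * x * (100000 * w') - 100000 * y * (100000 * w)
        = 100000 ^ 2 * (x * w' - y * w) by ring, abs_mul,
        abs_of_pos (by norm_num : (0 : ℝ) < 100000 ^ 2)] at e3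
      rw [show 100000 * x * (100000 * w') - 100000 * y * (100000 * w)
        = 100000 ^ 2 * (x * w' - y * w) by ring] at c2
      linarith
    have e4 : 0 ≤ u * w' - u' * w := by
      by_contra! hneg
      have := abs_nonneg (X * wy - Y * wx : ℝ)
      have e5 := abs_nonneg (x * w' - y * w)
      nlinarith
    have e6 : |(m : ℝ)| * (u * w' - u' * w) - |x * w' - y * w|
        ≤ |m * (u * w' - u' * w) + (x * w' - y * w)| := by
      have := abs_sub_abs_le_abs_sub (m * (u * w' - u' * w)) (-(x * w' - y * w))
      rwa [abs_mul, abs_of_nonneg e4, abs_neg, sub_neg_eq_add] at this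
    have e7 := mul_le_mul_of_nonneg_right hm' e4
    linarith
  -- The Cauchy-Schwarz inequality.
  have hcs : (v * w' - v' * w) ^ 2 ≤ (v ^ 2 + v' ^ 2) * (w ^ 2 + w' ^ 2) := by
    nlinarith [sq_nonneg (v * w + v' * w')]
  have hsq := pow_le_pow_left₀ hB0 hlow 2
  rw [mul_pow, sq_abs] at hsq
  have hW : 100000 ^ 2 * (w ^ 2 + w' ^ 2) ≤ (|(wx : ℝ)| + 12) ^ 2 + (|(wy : ℝ)| + 12) ^ 2 := by
    have b : ∀ {z : ℝ} {Z : ℤ}, |100000 * z - Z| ≤ 12 →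
        100000 ^ 2 * z ^ 2 ≤ (|(Z : ℝ)| + 12) ^ 2 := by
      intro z Z hz
      rw [← mul_pow, ← sq_abs (100000 * z)]
      refine pow_le_pow_left₀ (abs_nonneg _) ?_ 2
      have := abs_sub_abs_le_abs_sub (100000 * z) (Z : ℝ)
      linarith
    linarith [b hw, b hw']
  have h2' : (200000 : ℝ) ^ 2 * ((|(wx : ℝ)| + 12) ^ 2 + (|(wy : ℝ)| + 12) ^ 2) ≤ (B : ℝ) ^ 2 := by
    have : ((200000 ^ 2 * ((wx.natAbs + 12) ^ 2 + (wy.natAbs + 12) ^ 2 : ℕ) : ℤ) : ℝ)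
        ≤ ((B ^ 2 : ℤ) : ℝ) := by exact_mod_cast h2
    push_cast [Nat.cast_natAbs] at this
    linarith
  have hWpos : 0 < (|(wx : ℝ)| + 12) ^ 2 + (|(wy : ℝ)| + 12) ^ 2 := by positivity
  by_contra! hlt
  have hv0 : 0 ≤ v ^ 2 + v' ^ 2 := by positivity
  have hw0 : 0 ≤ 100000 ^ 2 * (w ^ 2 + w' ^ 2) := by positivity
  have f1 : (v ^ 2 + v' ^ 2) * (100000 ^ 2 * (w ^ 2 + w' ^ 2))
      ≤ (v ^ 2 + v' ^ 2) * ((|(wx : ℝ)| + 12) ^ 2 + (|(wy : ℝ)| + 12) ^ 2) :=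
    mul_le_mul_of_nonneg_left hW hv0
  have f2 : (v ^ 2 + v' ^ 2) * ((|(wx : ℝ)| + 12) ^ 2 + (|(wy : ℝ)| + 12) ^ 2)
      < 2 ^ 2 * ((|(wx : ℝ)| + 12) ^ 2 + (|(wy : ℝ)| + 12) ^ 2) :=
    mul_lt_mul_of_pos_right hlt hWpos
  linarith

theorem Listed.touches {T : List (Fin k × Label k)} (hT : ∀ p ∈ T, Q.Touches p.1 p.2)
    {i : Fin k} {l : Label k} (h : Listed T i l) : Q.Touches i l := by
  rcases h with h | h
  · exact hT _ h
  · exact Q.touches_swap (hT _ h)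

/-- A certificate implies that two discs are disjoint or tangent. -/
theorem Certificate.separated {T : List (Fin k × Label k)} {L : Fin k → ℕ × List (Label k)}
    (hc : A.Certificate T L) (hA : A.Approximates Q) (hT : ∀ p ∈ T, Q.Touches p.1 p.2)
    (hρ : ∀ i, Q.ρ i ≤ 1) {i : Fin k} {l : Label k} (hl : l ≠ (i, 0, 0)) :
    (Q.ρ i + Q.ρ l.1) ^ 2 ≤ Q.dx i l ^ 2 + Q.dy i l ^ 2 := by
  obtain ⟨hsep, -, hrow, hcol⟩ := hc
  obtain ⟨j, m, n⟩ := l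
  have h12 : ∀ {z : ℝ} {Z : ℤ}, |100000 * z - Z| ≤ 1 → |100000 * z - Z| ≤ 12 :=
    fun h => h.trans (by norm_num)
  have hneg : ∀ {z : ℝ} {Z : ℤ}, |100000 * z - Z| ≤ 1 → |100000 * (-z) - ((-Z : ℤ) : ℝ)| ≤ 12 := by
    intro z Z h
    rw [← abs_neg]
    push_cast
    refine le_trans (le_of_eq ?_) (h12 h)
    congr 1
    ring
  have hdiff : ∀ {z z' : ℝ} {Z Z' : ℤ}, |100000 * z - Z| ≤ 1 → |100000 * z' - Z'| ≤ 1 →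
      |100000 * (z - z') - ((Z - Z' : ℤ) : ℝ)| ≤ 12 := by
    intro z z' Z Z' h h'
    push_cast
    rw [abs_le] at *
    constructor <;> linarith
  have hρ2 : (Q.ρ i + Q.ρ j) ^ 2 ≤ 2 ^ 2 :=
    pow_le_pow_left₀ (add_nonneg (Q.ρ_pos i).le (Q.ρ_pos j).le) (by linarith [hρ i, hρ j]) 2
  rcases Nat.lt_or_ge m.natAbs 3 with hm | hm
  · rcases Nat.lt_or_ge n.natAbs 3 with hn | hn
    · have hnear : Near (k := k) (j, m, n) := by unfold Near; simp only; omega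
      have h := hsep i j (m + 2).toNat (by omega) (n + 2).toNat (by omega)
      rw [show (((m + 2).toNat : ℕ) : ℤ) - 2 = m by omega,
        show (((n + 2).toNat : ℕ) : ℤ) - 2 = n by omega] at h
      rcases h with h | h | h
      · exact h.le hA hnear
      · exact absurd h hl
      · exact (h.touches hT).ge
    · refine hρ2.trans (((hcol i j).four_le (n := -m) (h12 hA.wx) (h12 hA.wy) (hneg hA.ux)
        (hneg hA.uy) (hdiff (hA.x j) (hA.x i)) (hdiff (hA.y j) (hA.y i)) hn).trans (le_of_eq ?_))
      simp only [PeriodicFamily.dx, PeriodicFamily.dy]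
      push_cast
      ring
  · refine hρ2.trans (((hrow i j).four_le (n := n) (h12 hA.ux) (h12 hA.uy) (h12 hA.wx)
      (h12 hA.wy) (hdiff (hA.x j) (hA.x i)) (hdiff (hA.y j) (hA.y i)) hm).trans (le_of_eq ?_))
    simp only [PeriodicFamily.dx, PeriodicFamily.dy]
    ring

/-- A certified list is a ring, around each translate of the disc `i`. -/
theorem RingCheck.isRing {T : List (Fin k × Label k)} (hA : A.Approximates Q)
    (hT : ∀ p ∈ T, Q.Touches p.1 p.2) (a : Label k) {h : ℕ} {L : List (Label k)}
    (hL : A.RingCheck T a.1 h L) :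
    IsRing (Q.disc a) L.length
      (fun t => Q.disc (a.translate (L.getD (t % L.length) (a.1, 0, 0)))) := by
  obtain ⟨h0, hn, hL⟩ := hL
  have hpos : 0 < L.length := h0.trans hn
  set N := L.length with hN
  set e : ℕ → Label k := fun t => L.getD (t % N) (a.1, 0, 0) with he
  have hmod : ∀ t, t % N < N := fun t => Nat.mod_lt _ hpos
  have hnear : ∀ t, Near (e t) := fun t => (hL _ (hmod t)).1
  have hprop : ∀ t < N, Q.Touches a.1 (e t) ∧ Q.Touches (e t).1 ((e t).rel (e (t + 1))) ∧
      A.Turns a.1 (e t) (e (t + 1)) := by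
    intro t ht
    obtain ⟨-, h1, h2, h3, -⟩ := hL t ht
    simp only [he]
    rw [Nat.mod_eq_of_lt ht]
    exact ⟨h1.touches hT, h2.touches hT, h3⟩
  let d : ℕ → ℂ := fun t => (Q.disc (a.translate (e t))).center - (Q.disc a).center
  have hd : ∀ t, d t = ⟨Q.dx a.1 (e t), Q.dy a.1 (e t)⟩ := by
    intro t
    simp only [d]
    rw [Q.center_sub, Label.rel_translate]
  have hcross : ∀ t < N, 0 < (d (t + 1) / d t).arg := by
    intro t ht
    refine arg_pos_of_im_pos ?_
    have h1 := (hprop t ht).2.2.cross_pos hA (hnear t) (hnear (t + 1))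
    have hne : d t ≠ 0 := by
      intro h2
      rw [hd] at h2
      have h3 := congrArg Complex.re h2
      have h4 := congrArg Complex.im h2
      simp only [Complex.zero_re, Complex.zero_im] at h3 h4
      rw [h3, h4] at h1
      simp at h1
    rw [Complex.div_im, ← sub_div]
    refine div_pos ?_ (Complex.normSq_pos.2 hne)
    rw [hd, hd]
    simp only
    linarith
  have hclosed : e N = e 0 := by simp [he]
  -- Rotating the generic line to the real axis.
  let q : ℂ := ⟨1000, -137⟩
  have hq : q ≠ 0 := by
    intro h
    have := congrArg Complex.re h
    simp [q] at this
  have hrot : ∀ t, (q * d t).im = 1000 * Q.dy a.1 (e t) - 137 * Q.dx a.1 (e t) := by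
    intro t
    rw [hd, Complex.mul_im]
    simp only [q]
    ring
  have hside : ∀ t, |100000 * (q * d t).im
      - ((1000 * A.dy a.1 (e t) - 137 * A.dx a.1 (e t) : ℤ) : ℝ)| ≤ 12 * 1137 := by
    intro t
    have h1 := abs_le.1 (hA.dx_sub_le (i := a.1) (hnear t))
    have h2 := abs_le.1 (hA.dy_sub_le (i := a.1) (hnear t))
    rw [hrot, abs_le]
    push_cast
    constructor <;> linarith
  have hsum := sum_arg_div_eq_two_pi (d := fun t => q * d t) h0 hn (by simp only [d, hclosed])
    (by
      intro t ht
      rw [mul_div_mul_left _ _ hq]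
      exact hcross t ht)
    (by
      intro t ht
      obtain ⟨-, -, -, -, h1⟩ := hL t (ht.trans hn)
      have h2 := (abs_le.1 (hside t)).1
      simp only [he] at h2
      rw [Nat.mod_eq_of_lt (ht.trans hn)] at h2
      rw [if_pos ht] at h1
      have h3 := (Int.cast_lt (R := ℝ)).2 h1
      push_cast at h2 h3
      have : 0 < 100000 * (q * d t).im := by linarith
      linarith)
    (by
      intro t ht htn
      obtain ⟨-, -, -, -, h1⟩ := hL t htn
      have h2 := (abs_le.1 (hside t)).2
      simp only [he] at h2
      rw [Nat.mod_eq_of_lt htn] at h2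
      rw [if_neg (by omega)] at h1
      have h3 := (Int.cast_lt (R := ℝ)).2 h1
      push_cast at h2 h3
      have : 100000 * (q * d t).im < 0 := by linarith
      linarith)
  refine ⟨?_, ?_, ?_, ?_, ?_⟩
  · show Q.disc (a.translate (e N)) = Q.disc (a.translate (e 0))
    rw [hclosed]
  · intro t ht
    rw [Q.tangent_disc_iff, Label.rel_translate]
    exact (hprop t ht).1
  · intro t ht
    rw [Q.tangent_disc_iff, Label.translate_rel_translate]
    exact (hprop t ht).2.1
  · exact hcross
  · rw [← hsum]
    refine Finset.sum_congr rfl fun t _ => ?_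
    rw [mul_div_mul_left _ _ hq]
    rfl

/-- A periodic family of discs with a certificate is a compact packing. -/
theorem Certificate.isCompactPacking {T : List (Fin k × Label k)}
    {L : Fin k → ℕ × List (Label k)} (hc : A.Certificate T L) (hA : A.Approximates Q)
    (hT : ∀ p ∈ T, Q.Touches p.1 p.2) (hρ : ∀ i, Q.ρ i ≤ 1) :
    IsCompactPacking (Set.range Q.disc) := by
  constructor
  · rintro _ ⟨a, rfl⟩ _ ⟨b, rfl⟩ hne
    refine (disjoint_ball_ball_iff (Q.ρ_pos _) (Q.ρ_pos _)).2 ?_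
    refine abs_le_of_sq_le_sq' ?_ dist_nonneg |>.2
    rw [Q.sq_dist_disc]
    refine hc.separated hA hT hρ (i := a.1) (l := a.rel b) fun h => hne ?_
    obtain ⟨i, m, n⟩ := a
    obtain ⟨j, m', n'⟩ := b
    simp only [Label.rel, Prod.mk.injEq] at h
    obtain ⟨rfl, h1, h2⟩ := h
    rw [sub_eq_zero.1 h1, sub_eq_zero.1 h2]
  · rintro _ ⟨a, rfl⟩
    exact ⟨_, _, fun t => ⟨_, rfl⟩, (hc.2.1 a.1).isRing hA hT a⟩

end IntData

/-! ### The nine packings -/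

theorem IntData.Certificate.exists_packing {k : ℕ} {A : IntData k} {Q : PeriodicFamily k}
    {T : List (Fin k × Label k)} {L : Fin k → ℕ × List (Label k)} (hc : A.Certificate T L)
    (hA : A.Approximates Q) (hT : ∀ p ∈ T, Q.Touches p.1 p.2) {r : ℝ} (hr : r ≤ 1)
    (hρ : Set.range Q.ρ = {r, 1}) :
    ∃ P : Set Disc, IsCompactPacking P ∧ HasExactRadii P r 1 := by
  refine ⟨_, hc.isCompactPacking hA hT fun i => ?_, ?_⟩
  · have h : Q.ρ i ∈ ({r, 1} : Set ℝ) := hρ ▸ Set.mem_range_self i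
    rcases h with h | h
    · exact h.trans_le hr
    · exact le_of_eq h
  · unfold HasExactRadii
    rw [← hρ]
    ext x
    simp only [Set.mem_image, Set.mem_range]
    constructor
    · rintro ⟨_, ⟨l, rfl⟩, rfl⟩
      exact ⟨l.1, rfl⟩
    · rintro ⟨i, rfl⟩
      exact ⟨_, ⟨(i, 0, 0), rfl⟩, rfl⟩

theorem sqrt_three_bounds :
    √3 ^ 2 = 3 ∧ (1.7320508 : ℝ) < √3 ∧ √3 < 1.7320509 :=
  ⟨Real.sq_sqrt (by norm_num), by rw [Real.lt_sqrt] <;> norm_num,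
    by rw [Real.sqrt_lt'] <;> norm_num⟩

theorem mul_bounds {x y a b a' b' : ℝ} (ha : 0 ≤ a) (ha' : 0 ≤ a') (hx : a ≤ x) (hx' : x ≤ b)
    (hy : a' ≤ y) (hy' : y ≤ b') : a * a' ≤ x * y ∧ x * y ≤ b * b' :=
  ⟨mul_le_mul hx hy ha' (ha.trans hx), mul_le_mul hx' hy' (ha'.trans hy) (ha.trans (hx.trans hx'))⟩

/-- Approximate coordinates of the packing with pairs of small discs in equilateral hexagons. -/
def hexagonTilingData : IntData 4 where
  ux := 250835
  uy := -193432
  wx := 250835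
  wy := 193432
  x := ![150835, -150835, 0, 0]
  y := ![0, 0, 63756, -63756]
  ρ := ![100000, 100000, 63756, 63756]

/-- The tangencies in the packing with pairs of small discs in equilateral hexagons, one of each
orbit. -/
def hexagonTilingTangencies : List (Fin 4 × Label 4) := [
  (0, (1, 0, 1)), (0, (1, 1, 0)), (0, (1, 1, 1)), (0, (2, 0, 0)), (0, (2, 1, 0)), (0, (3, 0, 0)),
  (0, (3, 0, 1)), (1, (2, 0, -1)), (1, (2, 0, 0)), (1, (3, -1, 0)), (1, (3, 0, 0)),
  (2, (3, 0, 0))]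

/-- The rings in the packing with pairs of small discs in equilateral hexagons. -/
def hexagonTilingRings : Fin 4 → ℕ × List (Label 4) := ![
  (3, [
    (3, 0, 1), (1, 0, 1), (2, 0, 0), (3, 0, 0), (1, 1, 0), (2, 1, 0), (1, 1, 1)]),
  (4, [
    (2, 0, 0), (0, -1, 0), (3, -1, 0), (0, -1, -1), (2, 0, -1), (0, 0, -1), (3, 0, 0)]),
  (2, [
    (1, 0, 1), (0, -1, 0), (1, 0, 0), (3, 0, 0), (0, 0, 0)]),
  (3, [
    (0, 0, 0), (2, 0, 0), (1, 0, 0), (0, 0, -1), (1, 1, 0)])]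

theorem hexagonTiling_certificate :
    hexagonTilingData.Certificate hexagonTilingTangencies hexagonTilingRings := by
  decide +kernel

/-- Two touching small discs in an equilateral hexagon of large discs; translates of the hexagon
tile the plane. -/
theorem exists_packing_hexagonTiling {s : ℝ}
    (hs : s ^ 4 - 10 * s ^ 2 - 8 * s + 9 = 0)
    (hd : |s - 0.6375559772| < 1 / 10 ^ 10) :
    ∃ P : Set Disc, IsCompactPacking P ∧ HasExactRadii P s 1 := by
  rw [abs_lt] at hd
  obtain ⟨hl, hu⟩ := hd
  norm_num at hl hu
  have hs0 : 0 < s := by linarith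
  -- The vertices of the hexagon are `(±a, 0)` and `(±1, ±y)`, and the small discs have the
  -- centers `(0, ±s)`.
  have hs2 : 0.406477 < s ^ 2 ∧ s ^ 2 < 0.406478 := by constructor <;> nlinarith
  have hc : s ^ 2 + 2 * s - 1 ≠ 0 := by linarith
  obtain ⟨y, hy⟩ : ∃ y, (s ^ 2 + 2 * s - 1) * (y + 1) = 2 :=
    ⟨2 / (s ^ 2 + 2 * s - 1) - 1, by rw [sub_add_cancel, mul_div_cancel₀ _ hc]⟩
  obtain ⟨a, ha⟩ : ∃ a, a = s ^ 2 + 2 * s - 1 + s * (y - s) := ⟨_, rfl⟩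
  have h2 : (y - s) ^ 2 = 2 * s + s ^ 2 := by
    have h : (s ^ 2 + 2 * s - 1) ^ 2 * ((y - s) ^ 2 - (2 * s + s ^ 2)) = 0 := by
      linear_combination ((s ^ 2 + 2 * s - 1) * (y - 1 - 2 * s) + 2) * hy + hs
    have := (mul_eq_zero.1 h).resolve_left (pow_ne_zero 2 hc)
    linarith
  have h1 : a ^ 2 = 1 + 2 * s := by
    rw [ha]
    linear_combination 2 * s * hy + s ^ 2 * h2
  have h3 : (a - 1) ^ 2 + y ^ 2 = 4 := by
    linear_combination h1 + h2 - 2 * ha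
  have hyl : 1.934315 < y ∧ y < 1.934325 := by constructor <;> nlinarith
  have hal : 1.508345 < a ∧ a < 1.508355 := by
    rw [ha]; constructor <;> nlinarith
  refine hexagonTiling_certificate.exists_packing (Q :=
    { ux := a + 1
      uy := -y
      wx := a + 1
      wy := y
      x := ![a, -a, 0, 0]
      y := ![0, 0, s, -s]
      ρ := ![1, 1, s, s]
      ρ_pos := by simp [Fin.forall_fin_succ, hs0] }) ?_ ?_ (by linarith) ?_
  · refine ⟨?_, ?_, ?_, ?_, ?_, ?_, ?_⟩ <;>
      simp [Fin.forall_fin_succ, hexagonTilingData, abs_le]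
    all_goals and_intros <;> linarith
  · simp only [hexagonTilingTangencies, List.forall_mem_cons, List.not_mem_nil, false_imp_iff,
      implies_true, and_true]
    and_intros <;> simp [PeriodicFamily.Touches, PeriodicFamily.dx, PeriodicFamily.dy]
    all_goals grind
  · ext z
    simp [eq_comm]

/-- Approximate coordinates of the packing with triples of small discs in the hexagons of a
twisted kagome lattice. -/
def twistedKagomeData : IntData 6 where
  ux := 393517
  uy := 0
  wx := 196758
  wy := 340796
  x := ![217464, -108732, -108732, 62949, -31474, -31474]
  y := ![0, 188329, -188329, 0, 54515, -54515]
  ρ := ![100000, 100000, 100000, 54515, 54515, 54515]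

/-- The tangencies in the packing with triples of small discs in the hexagons of a twisted kagome
lattice, one of each orbit. -/
def twistedKagomeTangencies : List (Fin 6 × Label 6) := [
  (0, (1, 1, -1)), (0, (1, 1, 0)), (0, (2, 0, 1)), (0, (2, 1, 0)), (0, (3, 0, 0)),
  (0, (4, 1, 0)), (0, (5, 1, 0)), (1, (2, -1, 1)), (1, (2, 0, 1)), (1, (3, -1, 1)),
  (1, (4, 0, 0)), (1, (5, -1, 1)), (2, (3, 0, -1)), (2, (4, 0, -1)), (2, (5, 0, 0)),
  (3, (4, 0, 0)), (3, (5, 0, 0)), (4, (5, 0, 0))]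

/-- The rings in the packing with triples of small discs in the hexagons of a twisted kagome
lattice. -/
def twistedKagomeRings : Fin 6 → ℕ × List (Label 6) := ![
  (4, [
    (4, 1, 0), (1, 1, 0), (2, 0, 1), (3, 0, 0), (1, 1, -1), (2, 1, 0), (5, 1, 0)]),
  (3, [
    (0, -1, 1), (3, -1, 1), (5, -1, 1), (2, -1, 1), (0, -1, 0), (4, 0, 0), (2, 0, 1)]),
  (4, [
    (1, 1, -1), (5, 0, 0), (0, -1, 0), (1, 0, -1), (4, 0, -1), (3, 0, -1), (0, 0, -1)]),
  (2, [
    (2, 0, 1), (4, 0, 0), (5, 0, 0), (1, 1, -1), (0, 0, 0)]),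
  (2, [
    (2, 0, 1), (1, 0, 0), (0, -1, 0), (5, 0, 0), (3, 0, 0)]),
  (3, [
    (3, 0, 0), (4, 0, 0), (0, -1, 0), (2, 0, 0), (1, 1, -1)])]

theorem twistedKagome_certificate :
    twistedKagomeData.Certificate twistedKagomeTangencies twistedKagomeRings := by
  decide +kernel

/-- Three touching small discs in each hexagon of a twisted kagome lattice, whose triangles and
hexagons have large discs as vertices. -/
theorem exists_packing_twistedKagome {s : ℝ}
    (hs : (7 + 4 * √3) * s ^ 4 + (20 + 12 * √3) * s ^ 3
      + (6 + 4 * √3) * s ^ 2 + (-20 - 4 * √3) * s + 3 = 0)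
    (hd : |s - 0.5451510421| < 1 / 10 ^ 10) :
    ∃ P : Set Disc, IsCompactPacking P ∧ HasExactRadii P s 1 := by
  rw [abs_lt] at hd
  obtain ⟨hl, hu⟩ := hd
  norm_num at hl hu
  have hs0 : 0 < s := by linarith
  obtain ⟨ht2, htl, htu⟩ := sqrt_three_bounds
  generalize √3 = t at *
  have hts := mul_bounds (by norm_num) (by norm_num) htl.le htu.le (a' := 0.545151042)
    (b' := 0.5451510422) (y := s) (by linarith) (by linarith)
  norm_num at hts
  have hs2 : 0.297189 < s ^ 2 ∧ s ^ 2 < 0.29719 := by constructor <;> nlinarith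
  obtain ⟨g, hg⟩ : ∃ g, 3 * g = t * s := ⟨t * s / 3, by ring⟩
  obtain ⟨e, he⟩ : ∃ e, e * (1 + s) = 2 * s ^ 2 + 4 * s - 2 + t * s * (1 + s) :=
    ⟨(2 * s ^ 2 + 4 * s - 2 + t * s * (1 + s)) / (1 + s), by field_simp⟩
  have he2 : e ^ 2 = 1 + 2 * s := by
    have h : (1 + s) ^ 2 * (e ^ 2 - (1 + 2 * s)) = 0 := by
      linear_combination (e * (1 + s) + 2 * s ^ 2 + 4 * s - 2 + t * s * (1 + s)) * he + hs
        + (s * (1 + s)) ^ 2 * ht2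
    have := (mul_eq_zero.1 h).resolve_left (by positivity)
    linarith
  -- The vertices of a hexagon have the distances `a` and `b` from its center.
  obtain ⟨a, ha⟩ : ∃ a, a = g + e := ⟨_, rfl⟩
  obtain ⟨b, hb⟩ : ∃ b, b = 2 * g + 1 + s := ⟨_, rfl⟩
  have hgt : g * t = s := by linear_combination t / 3 * hg + s / 3 * ht2
  have hg2 : 3 * g ^ 2 = s ^ 2 := by linear_combination g * hg + s * hgt
  have hab : a ^ 2 + b ^ 2 - a * b = 4 := by
    rw [ha, hb]
    linear_combination he2 - he + hg2 + (1 + s) * hg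
  have he0 : 0 < e := by
    refine pos_of_mul_pos_left (b := 1 + s) ?_ (by linarith)
    rw [he]
    have : 0 ≤ t * s * (1 + s) := mul_nonneg (by linarith) (by linarith)
    linarith
  have hel : 1.445787 < e ∧ e < 1.445789 :=
    ⟨lt_of_pow_lt_pow_left₀ 2 he0.le (by rw [he2]; norm_num; linarith),
      lt_of_pow_lt_pow_left₀ 2 (by norm_num) (by rw [he2]; norm_num; linarith)⟩
  have htb := mul_bounds (by norm_num) (by norm_num) htl.le htu.le (a' := 2.174636)
    (b' := 2.174638) (y := b) (by linarith) (by linarith)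
  have hta := mul_bounds (by norm_num) (by norm_num) htl.le htu.le (a' := 1.760529)
    (b' := 1.760534) (y := a) (by linarith) (by linarith)
  norm_num at hta htb
  refine twistedKagome_certificate.exists_packing (Q :=
    { ux := a + b
      uy := 0
      wx := (a + b) / 2
      wy := t * (a + b) / 2
      x := ![b, -b / 2, -b / 2, 2 * g, -g, -g]
      y := ![0, t * b / 2, -t * b / 2, 0, s, -s]
      ρ := ![1, 1, 1, s, s, s]
      ρ_pos := by simp [Fin.forall_fin_succ, hs0] }) ?_ ?_ (by linarith) ?_
  · refine ⟨?_, ?_, ?_, ?_, ?_, ?_, ?_⟩ <;>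
      simp [Fin.forall_fin_succ, twistedKagomeData, abs_le]
    all_goals and_intros <;> linarith
  · simp only [twistedKagomeTangencies, List.forall_mem_cons, List.not_mem_nil, false_imp_iff,
      implies_true, and_true]
    and_intros <;> simp [PeriodicFamily.Touches, PeriodicFamily.dx, PeriodicFamily.dy]
    all_goals grind
  · ext z
    simp [eq_comm]

/-- Approximate coordinates of the packing with zigzags of small discs between double rows of
large discs. -/
def zigzagData : IntData 4 where
  ux := 200000
  uy := 0
  wx := 0
  wy := 442767
  x := ![0, 100000, 100000, 0]
  y := ![134781, -134781, 18549, -18549]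
  ρ := ![100000, 100000, 53330, 53330]

/-- The tangencies in the packing with zigzags of small discs between double rows of large discs,
one of each orbit. -/
def zigzagTangencies : List (Fin 4 × Label 4) := [
  (0, (0, -1, 0)), (0, (1, -1, 1)), (0, (1, 0, 1)), (0, (2, -1, 0)), (0, (2, 0, 0)),
  (0, (3, 0, 0)), (1, (1, -1, 0)), (1, (2, 0, 0)), (1, (3, 0, 0)), (1, (3, 1, 0)),
  (2, (3, 0, 0)), (2, (3, 1, 0))]

/-- The rings in the packing with zigzags of small discs between double rows of large discs. -/
def zigzagRings : Fin 4 → ℕ × List (Label 4) := ![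
  (3, [
    (1, 0, 1), (1, -1, 1), (0, -1, 0), (2, -1, 0), (3, 0, 0), (2, 0, 0), (0, 1, 0)]),
  (4, [
    (3, 1, 0), (2, 0, 0), (3, 0, 0), (1, -1, 0), (0, 0, -1), (0, 1, -1), (1, 1, 0)]),
  (2, [
    (0, 1, 0), (0, 0, 0), (3, 0, 0), (1, 0, 0), (3, 1, 0)]),
  (3, [
    (2, 0, 0), (0, 0, 0), (2, -1, 0), (1, -1, 0), (1, 0, 0)])]

theorem zigzag_certificate :
    zigzagData.Certificate zigzagTangencies zigzagRings := by
  decide +kernel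

/-- Two rows of touching large discs face each other with a zigzag of small discs in between. -/
theorem exists_packing_zigzag {s : ℝ}
    (hs : 8 * s ^ 3 + 3 * s ^ 2 - 2 * s - 1 = 0)
    (hd : |s - 0.5332964167| < 1 / 10 ^ 10) :
    ∃ P : Set Disc, IsCompactPacking P ∧ HasExactRadii P s 1 := by
  rw [abs_lt] at hd
  obtain ⟨hl, hu⟩ := hd
  norm_num at hl hu
  have hs0 : 0 < s := by linarith
  obtain ⟨ht2, htl, htu⟩ := sqrt_three_bounds
  generalize √3 = t at *
  have hs2 : 0.284405 < s ^ 2 ∧ s ^ 2 < 0.284406 := by constructor <;> nlinarith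
  -- The centers of the small discs have the heights `±v`, and those of the large ones `±h`.
  obtain ⟨v, hv⟩ : ∃ v, v * (1 + s) = s ^ 2 := ⟨s ^ 2 / (1 + s), by field_simp⟩
  obtain ⟨h, hh⟩ : ∃ h, h = 1 + s - v := ⟨_, rfl⟩
  have h1 : 1 + 4 * v ^ 2 = 4 * s ^ 2 := by
    have h : (1 + s) ^ 2 * (1 + 4 * v ^ 2 - 4 * s ^ 2) = 0 := by
      linear_combination 4 * (v * (1 + s) + s ^ 2) * hv - hs
    have := (mul_eq_zero.1 h).resolve_left (by positivity)
    linarith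
  have h2 : 4 * v * h = 1 := by
    rw [hh]
    linear_combination 4 * hv - h1
  have hvl : 0.185486 < v ∧ v < 0.185487 := by constructor <;> nlinarith
  refine zigzag_certificate.exists_packing (Q :=
    { ux := 2
      uy := 0
      wx := 0
      wy := 2 * h + t
      x := ![0, 1, 1, 0]
      y := ![h, -h, v, -v]
      ρ := ![1, 1, s, s]
      ρ_pos := by simp [Fin.forall_fin_succ, hs0] }) ?_ ?_ (by linarith) ?_
  · refine ⟨?_, ?_, ?_, ?_, ?_, ?_, ?_⟩ <;>
      simp [Fin.forall_fin_succ, zigzagData, abs_le]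
    all_goals and_intros <;> linarith
  · simp only [zigzagTangencies, List.forall_mem_cons, List.not_mem_nil, false_imp_iff,
      implies_true, and_true]
    and_intros <;> simp [PeriodicFamily.Touches, PeriodicFamily.dx, PeriodicFamily.dy]
    all_goals grind
  · ext z
    simp [eq_comm]

/-- Approximate coordinates of the square packing with a small disc in each hole. -/
def squareData : IntData 2 where
  ux := 200000
  uy := 0
  wx := 0
  wy := 200000
  x := ![0, 100000]
  y := ![0, 100000]
  ρ := ![100000, 41421]

/-- The tangencies in the square packing with a small disc in each hole, one of each orbit. -/
def squareTangencies : List (Fin 2 × Label 2) := [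
  (0, (0, -1, 0)), (0, (0, 0, -1)), (0, (1, -1, -1)), (0, (1, -1, 0)), (0, (1, 0, -1)),
  (0, (1, 0, 0))]

/-- The rings in the square packing with a small disc in each hole. -/
def squareRings : Fin 2 → ℕ × List (Label 2) := ![
  (4, [
    (1, 0, 0), (0, 0, 1), (1, -1, 0), (0, -1, 0), (1, -1, -1), (0, 0, -1), (1, 0, -1), (0, 1, 0)]),
  (2, [
    (0, 1, 1), (0, 0, 1), (0, 0, 0), (0, 1, 0)])]

theorem square_certificate :
    squareData.Certificate squareTangencies squareRings := by
  decide +kernel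

/-- A small disc in each hole of the square packing. -/
theorem exists_packing_square {s : ℝ}
    (hs : s = √2 - 1) (hd : |s - 0.4142135624| < 1 / 10 ^ 10) :
    ∃ P : Set Disc, IsCompactPacking P ∧ HasExactRadii P s 1 := by
  rw [abs_lt] at hd
  obtain ⟨hl, hu⟩ := hd
  norm_num at hl hu
  have hs0 : 0 < s := by linarith
  have h1 : (1 + s) ^ 2 = 2 := by
    rw [hs, add_sub_cancel, Real.sq_sqrt (by norm_num)]
  refine square_certificate.exists_packing (Q :=
    { ux := 2
      uy := 0
      wx := 0
      wy := 2
      x := ![0, 1]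
      y := ![0, 1]
      ρ := ![1, s]
      ρ_pos := by simp [Fin.forall_fin_succ, hs0] }) ?_ ?_ (by linarith) ?_
  · refine ⟨?_, ?_, ?_, ?_, ?_, ?_, ?_⟩ <;>
      simp [Fin.forall_fin_succ, squareData, abs_le]
    all_goals and_intros <;> linarith
  · simp only [squareTangencies, List.forall_mem_cons, List.not_mem_nil, false_imp_iff,
      implies_true, and_true]
    and_intros <;> simp [PeriodicFamily.Touches, PeriodicFamily.dx, PeriodicFamily.dy]
    all_goals grind
  · ext z
    simp [eq_comm]

/-- Approximate coordinates of the honeycomb packing with seven small discs in each hexagon. -/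
def honeycombData : IntData 9 where
  ux := 300000
  uy := 173205
  wx := 0
  wy := 346410
  x := ![200000, -200000, 0, 66876, 0, -66876, -66876, 0, 66876]
  y := ![0, 0, 0, 38611, 77221, 38611, -38611, -77221, -38611]
  ρ := ![100000, 100000, 38611, 38611, 38611, 38611, 38611, 38611, 38611]

/-- The tangencies in the honeycomb packing with seven small discs in each hexagon, one of each
orbit. -/
def honeycombTangencies : List (Fin 9 × Label 9) := [
  (0, (1, 1, -1)), (0, (1, 1, 0)), (0, (1, 2, -1)), (0, (3, 0, 0)), (0, (4, 1, -1)),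
  (0, (5, 1, -1)), (0, (6, 1, 0)), (0, (7, 1, 0)), (0, (8, 0, 0)), (1, (3, -1, 0)),
  (1, (4, -1, 0)), (1, (5, 0, 0)), (1, (6, 0, 0)), (1, (7, -1, 1)), (1, (8, -1, 1)),
  (2, (3, 0, 0)), (2, (4, 0, 0)), (2, (5, 0, 0)), (2, (6, 0, 0)), (2, (7, 0, 0)), (2, (8, 0, 0)),
  (3, (4, 0, 0)), (3, (8, 0, 0)), (4, (5, 0, 0)), (5, (6, 0, 0)), (6, (7, 0, 0)), (7, (8, 0, 0))]

/-- The rings in the honeycomb packing with seven small discs in each hexagon. -/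
def honeycombRings : Fin 9 → ℕ × List (Label 9) := ![
  (4, [
    (7, 1, 0), (6, 1, 0), (1, 1, 0), (3, 0, 0), (8, 0, 0), (1, 1, -1), (5, 1, -1), (4, 1, -1),
    (1, 2, -1)]),
  (5, [
    (5, 0, 0), (0, -1, 1), (8, -1, 1), (7, -1, 1), (0, -2, 1), (4, -1, 0), (3, -1, 0),
    (0, -1, 0), (6, 0, 0)]),
  (3, [
    (3, 0, 0), (4, 0, 0), (5, 0, 0), (6, 0, 0), (7, 0, 0), (8, 0, 0)]),
  (2, [
    (1, 1, 0), (4, 0, 0), (2, 0, 0), (8, 0, 0), (0, 0, 0)]),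
  (2, [
    (1, 1, 0), (0, -1, 1), (5, 0, 0), (2, 0, 0), (3, 0, 0)]),
  (2, [
    (4, 0, 0), (0, -1, 1), (1, 0, 0), (6, 0, 0), (2, 0, 0)]),
  (3, [
    (2, 0, 0), (5, 0, 0), (1, 0, 0), (0, -1, 0), (7, 0, 0)]),
  (3, [
    (8, 0, 0), (2, 0, 0), (6, 0, 0), (0, -1, 0), (1, 1, -1)]),
  (3, [
    (0, 0, 0), (3, 0, 0), (2, 0, 0), (7, 0, 0), (1, 1, -1)])]

theorem honeycomb_certificate :
    honeycombData.Certificate honeycombTangencies honeycombRings := by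
  decide +kernel

/-- Seven small discs in each hexagon of a honeycomb of large discs. -/
theorem exists_packing_honeycomb {s : ℝ}
    (hs : s = (2 * √3 + 1 - 2 * √(1 + √3)) / 3)
    (hd : |s - 0.3861061049| < 1 / 10 ^ 10) :
    ∃ P : Set Disc, IsCompactPacking P ∧ HasExactRadii P s 1 := by
  rw [abs_lt] at hd
  obtain ⟨hl, hu⟩ := hd
  norm_num at hl hu
  have hs0 : 0 < s := by linarith
  have h6 : √(1 + √3) ^ 2 = 1 + √3 := Real.sq_sqrt (by positivity)
  obtain ⟨ht2, htl, htu⟩ := sqrt_three_bounds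
  generalize √3 = t at *
  have h1 : 3 * s ^ 2 - (4 * t + 2) * s + 3 = 0 := by
    rw [hs]
    linear_combination 4 / 3 * h6 - 4 / 3 * ht2
  have hts := mul_bounds (by norm_num) (by norm_num) htl.le htu.le (a' := 0.3861061048)
    (b' := 0.386106105) (y := s) (by linarith) (by linarith)
  norm_num at hts
  refine honeycomb_certificate.exists_packing (Q :=
    { ux := 3
      uy := t
      wx := 0
      wy := 2 * t
      x := ![2, -2, 0, t * s, 0, -(t * s), -(t * s), 0, t * s]
      y := ![0, 0, 0, s, 2 * s, s, -s, -(2 * s), -s]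
      ρ := ![1, 1, s, s, s, s, s, s, s]
      ρ_pos := by simp [Fin.forall_fin_succ, hs0] }) ?_ ?_ (by linarith) ?_
  · refine ⟨?_, ?_, ?_, ?_, ?_, ?_, ?_⟩ <;>
      simp [Fin.forall_fin_succ, honeycombData, abs_le]
    all_goals and_intros <;> linarith
  · simp only [honeycombTangencies, List.forall_mem_cons, List.not_mem_nil, false_imp_iff,
      implies_true, and_true]
    and_intros <;> simp [PeriodicFamily.Touches, PeriodicFamily.dx, PeriodicFamily.dy]
    all_goals grind
  · ext z
    simp [eq_comm]

/-- Approximate coordinates of the packing with the small discs at the vertices of a truncated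
hexagonal tiling. -/
def truncatedHexagonalData : IntData 7 where
  ux := 260645
  uy := 0
  wx := 130323
  wy := 225725
  x := ![0, 130323, 34920, -95403, -130323, -34920, 95403]
  y := ![0, 34920, 130323, 95403, -34920, -130323, -95403]
  ρ := ![100000, 34920, 34920, 34920, 34920, 34920, 34920]

/-- The tangencies in the packing with the small discs at the vertices of a truncated hexagonal
tiling, one of each orbit. -/
def truncatedHexagonalTangencies : List (Fin 7 × Label 7) := [
  (0, (1, -1, 0)), (0, (1, 0, 0)), (0, (2, 0, -1)), (0, (2, 0, 0)), (0, (3, 0, 0)),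
  (0, (3, 1, -1)), (0, (4, 0, 0)), (0, (4, 1, 0)), (0, (5, 0, 0)), (0, (5, 0, 1)),
  (0, (6, -1, 1)), (0, (6, 0, 0)), (1, (3, 1, 0)), (1, (4, 1, 0)), (1, (5, 0, 1)),
  (2, (4, 0, 1)), (2, (5, 0, 1)), (2, (6, -1, 1)), (3, (5, -1, 1)), (3, (6, -1, 1)),
  (4, (6, -1, 0))]

/-- The rings in the packing with the small discs at the vertices of a truncated hexagonal tiling.
-/
def truncatedHexagonalRings : Fin 7 → ℕ × List (Label 7) := ![
  (6, [
    (1, 0, 0), (5, 0, 1), (2, 0, 0), (6, -1, 1), (3, 0, 0), (1, -1, 0), (4, 0, 0), (2, 0, -1),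
    (5, 0, 0), (3, 1, -1), (6, 0, 0), (4, 1, 0)]),
  (2, [
    (3, 1, 0), (5, 0, 1), (0, 0, 0), (4, 1, 0), (0, 1, 0)]),
  (3, [
    (0, 0, 1), (4, 0, 1), (6, -1, 1), (0, 0, 0), (5, 0, 1)]),
  (3, [
    (6, -1, 1), (0, -1, 1), (5, -1, 1), (1, -1, 0), (0, 0, 0)]),
  (3, [
    (0, 0, 0), (1, -1, 0), (0, -1, 0), (6, -1, 0), (2, 0, -1)]),
  (2, [
    (0, 0, 0), (2, 0, -1), (0, 0, -1), (1, 0, -1), (3, 1, -1)]),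
  (2, [
    (4, 1, 0), (0, 0, 0), (3, 1, -1), (0, 1, -1), (2, 1, -1)])]

theorem truncatedHexagonal_certificate :
    truncatedHexagonalData.Certificate truncatedHexagonalTangencies truncatedHexagonalRings := by
  decide +kernel

/-- The small discs are centered at the vertices of a truncated hexagonal tiling, the large
ones in its dodecagons. -/
theorem exists_packing_truncatedHexagonal {s : ℝ}
    (hs : s = Real.sin (Real.pi / 12) / (1 - Real.sin (Real.pi / 12)))
    (hd : |s - 0.3491981862| < 1 / 10 ^ 10) :
    ∃ P : Set Disc, IsCompactPacking P ∧ HasExactRadii P s 1 := by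
  rw [abs_lt] at hd
  obtain ⟨hl, hu⟩ := hd
  norm_num at hl hu
  have hs0 : 0 < s := by linarith
  -- The dodecagon has the inradius `h`.
  obtain ⟨h, hh⟩ : ∃ h, h = (1 + s) * Real.cos (Real.pi / 12) := ⟨_, rfl⟩
  have hsin : s = (1 + s) * Real.sin (Real.pi / 12) := by
    have h1 : 1 - Real.sin (Real.pi / 12) ≠ 0 := by
      intro h0
      rw [h0, div_zero] at hs
      exact hs0.ne' hs
    rw [eq_div_iff h1] at hs
    linarith
  have h1 : h ^ 2 + s ^ 2 = (1 + s) ^ 2 := by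
    have h2 := Real.sin_sq_add_cos_sq (Real.pi / 12)
    have h3 : s ^ 2 = ((1 + s) * Real.sin (Real.pi / 12)) ^ 2 := by rw [← hsin]
    rw [hh, h3]
    linear_combination (1 + s) ^ 2 * h2
  have h2 : 4 * h * s = (1 + s) ^ 2 := by
    have h3 := Real.sin_two_mul (Real.pi / 12)
    rw [show 2 * (Real.pi / 12) = Real.pi / 6 by ring, Real.sin_pi_div_six] at h3
    rw [hh]
    linear_combination 4 * (1 + s) * Real.cos (Real.pi / 12) * hsin - 2 * (1 + s) ^ 2 * h3
  have hhl : 1.303225 < h ∧ h < 1.303226 := by constructor <;> nlinarith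
  refine truncatedHexagonal_certificate.exists_packing (Q :=
    { ux := 2 * h
      uy := 0
      wx := h
      wy := 2 * h - s
      x := ![0, h, s, s - h, -h, -s, h - s]
      y := ![0, s, h, h - s, -s, -h, s - h]
      ρ := ![1, s, s, s, s, s, s]
      ρ_pos := by simp [Fin.forall_fin_succ, hs0] }) ?_ ?_ (by linarith) ?_
  · refine ⟨?_, ?_, ?_, ?_, ?_, ?_, ?_⟩ <;>
      simp [Fin.forall_fin_succ, truncatedHexagonalData, abs_le]
    all_goals and_intros <;> linarith
  · simp only [truncatedHexagonalTangencies, List.forall_mem_cons, List.not_mem_nil, false_imp_iff,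
      implies_true, and_true]
    and_intros <;> simp [PeriodicFamily.Touches, PeriodicFamily.dx, PeriodicFamily.dy]
    all_goals grind
  · ext z
    simp [eq_comm]

/-- Approximate coordinates of the rhombic packing with two small discs in each hole. -/
def rhombicData : IntData 3 where
  ux := 156155
  uy := -124962
  wx := 156155
  wy := 124962
  x := ![0, 28078, -28078]
  y := ![124962, 0, 0]
  ρ := ![100000, 28078, 28078]

/-- The tangencies in the rhombic packing with two small discs in each hole, one of each orbit. -/
def rhombicTangencies : List (Fin 3 × Label 3) := [
  (0, (0, -1, 0)), (0, (0, 0, -1)), (0, (1, -1, 0)), (0, (1, -1, 1)), (0, (1, 0, 0)),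
  (0, (2, -1, 1)), (0, (2, 0, 0)), (0, (2, 0, 1)), (1, (2, 0, 0))]

/-- The rings in the rhombic packing with two small discs in each hole. -/
def rhombicRings : Fin 3 → ℕ × List (Label 3) := ![
  (5, [
    (0, 0, 1), (1, -1, 1), (2, -1, 1), (0, -1, 0), (1, -1, 0), (0, 0, -1), (2, 0, 0), (1, 0, 0),
    (0, 1, 0), (2, 0, 1)]),
  (2, [
    (0, 0, 0), (2, 0, 0), (0, 1, -1), (0, 1, 0)]),
  (2, [
    (0, 0, 0), (0, 0, -1), (0, 1, -1), (1, 0, 0)])]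

theorem rhombic_certificate :
    rhombicData.Certificate rhombicTangencies rhombicRings := by
  decide +kernel

/-- Two touching small discs in each rhombus of a lattice of large discs. -/
theorem exists_packing_rhombic {s : ℝ}
    (hs : s = (√17 - 3) / 4)
    (hd : |s - 0.2807764064| < 1 / 10 ^ 10) :
    ∃ P : Set Disc, IsCompactPacking P ∧ HasExactRadii P s 1 := by
  rw [abs_lt] at hd
  obtain ⟨hl, hu⟩ := hd
  norm_num at hl hu
  have hs0 : 0 < s := by linarith
  have h1 : 2 * s ^ 2 + 3 * s - 1 = 0 := by
    have h17 : √17 ^ 2 = 17 := Real.sq_sqrt (by norm_num)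
    rw [hs]
    linear_combination 1 / 8 * h17
  -- The rhombus has the vertices `(0, ±a)` and `(±(1 + 2 * s), 0)`.
  obtain ⟨a, ha⟩ : ∃ a, a = √(1 + 2 * s) := ⟨_, rfl⟩
  have ha2 : a ^ 2 = 1 + 2 * s := by rw [ha, Real.sq_sqrt (by linarith)]
  have hal : 1.249621 < a := by rw [ha]; refine Real.lt_sqrt_of_sq_lt ?_; norm_num; linarith
  have hau : a < 1.249622 := by rw [ha, Real.sqrt_lt' (by norm_num)]; norm_num; linarith
  refine rhombic_certificate.exists_packing (Q :=
    { ux := 1 + 2 * s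
      uy := -a
      wx := 1 + 2 * s
      wy := a
      x := ![0, s, -s]
      y := ![a, 0, 0]
      ρ := ![1, s, s]
      ρ_pos := by simp [Fin.forall_fin_succ, hs0] }) ?_ ?_ (by linarith) ?_
  · refine ⟨?_, ?_, ?_, ?_, ?_, ?_, ?_⟩ <;>
      simp [Fin.forall_fin_succ, rhombicData, abs_le]
    all_goals and_intros <;> linarith
  · simp only [rhombicTangencies, List.forall_mem_cons, List.not_mem_nil, false_imp_iff,
      implies_true, and_true]
    and_intros <;> simp [PeriodicFamily.Touches, PeriodicFamily.dx, PeriodicFamily.dy]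
    all_goals grind
  · ext z
    simp [eq_comm]

/-- Approximate coordinates of the triangular packing with a small disc in each hole. -/
def triangularData : IntData 3 where
  ux := 200000
  uy := 0
  wx := 100000
  wy := 173205
  x := ![0, 100000, 100000]
  y := ![0, 57735, -57735]
  ρ := ![100000, 15470, 15470]

/-- The tangencies in the triangular packing with a small disc in each hole, one of each orbit. -/
def triangularTangencies : List (Fin 3 × Label 3) := [
  (0, (0, -1, 0)), (0, (0, -1, 1)), (0, (0, 0, -1)), (0, (1, -1, 0)), (0, (1, 0, -1)),
  (0, (1, 0, 0)), (0, (2, -1, 0)), (0, (2, -1, 1)), (0, (2, 0, 0))]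

/-- The rings in the triangular packing with a small disc in each hole. -/
def triangularRings : Fin 3 → ℕ × List (Label 3) := ![
  (6, [
    (1, 0, 0), (0, 0, 1), (2, -1, 1), (0, -1, 1), (1, -1, 0), (0, -1, 0), (2, -1, 0), (0, 0, -1),
    (1, 0, -1), (0, 1, -1), (2, 0, 0), (0, 1, 0)]),
  (1, [
    (0, 0, 1), (0, 0, 0), (0, 1, 0)]),
  (2, [
    (0, 1, 0), (0, 0, 0), (0, 1, -1)])]

theorem triangular_certificate :
    triangularData.Certificate triangularTangencies triangularRings := by
  decide +kernel

/-- A small disc in each hole of the triangular packing. -/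
theorem exists_packing_triangular {s : ℝ}
    (hs : s = 2 * √3 / 3 - 1)
    (hd : |s - 0.1547005384| < 1 / 10 ^ 10) :
    ∃ P : Set Disc, IsCompactPacking P ∧ HasExactRadii P s 1 := by
  rw [abs_lt] at hd
  obtain ⟨hl, hu⟩ := hd
  norm_num at hl hu
  have hs0 : 0 < s := by linarith
  obtain ⟨ht2, htl, htu⟩ := sqrt_three_bounds
  generalize √3 = t at *
  refine triangular_certificate.exists_packing (Q :=
    { ux := 2
      uy := 0
      wx := 1
      wy := t
      x := ![0, 1, 1]
      y := ![0, t / 3, -t / 3]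
      ρ := ![1, s, s]
      ρ_pos := by simp [Fin.forall_fin_succ, hs0] }) ?_ ?_ (by linarith) ?_
  · refine ⟨?_, ?_, ?_, ?_, ?_, ?_, ?_⟩ <;>
      simp [Fin.forall_fin_succ, triangularData, abs_le]
    all_goals and_intros <;> linarith
  · simp only [triangularTangencies, List.forall_mem_cons, List.not_mem_nil, false_imp_iff,
      implies_true, and_true]
    and_intros <;> simp [PeriodicFamily.Touches, PeriodicFamily.dx, PeriodicFamily.dy]
    all_goals grind
  · ext z
    simp [eq_comm]

/-- Approximate coordinates of the triangular packing with three small discs in each hole. -/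
def tripleHoleData : IntData 7 where
  ux := 200000
  uy := 0
  wx := 100000
  wy := 173205
  x := ![0, 100000, 110102, 89898, 100000, 110102, 89898]
  y := ![0, 46070, 63567, 63567, -46070, -63567, -63567]
  ρ := ![100000, 10102, 10102, 10102, 10102, 10102, 10102]

/-- The tangencies in the triangular packing with three small discs in each hole, one of each
orbit. -/
def tripleHoleTangencies : List (Fin 7 × Label 7) := [
  (0, (0, -1, 0)), (0, (0, -1, 1)), (0, (0, 0, -1)), (0, (1, -1, 0)), (0, (1, 0, 0)),
  (0, (2, -1, 0)), (0, (2, 0, -1)), (0, (3, 0, -1)), (0, (3, 0, 0)), (0, (4, -1, 0)),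
  (0, (4, 0, 0)), (0, (5, -1, 0)), (0, (5, -1, 1)), (0, (6, -1, 1)), (0, (6, 0, 0)),
  (1, (2, 0, 0)), (1, (3, 0, 0)), (2, (3, 0, 0)), (4, (5, 0, 0)), (4, (6, 0, 0)), (5, (6, 0, 0))]

/-- The rings in the triangular packing with three small discs in each hole. -/
def tripleHoleRings : Fin 7 → ℕ × List (Label 7) := ![
  (9, [
    (1, 0, 0), (3, 0, 0), (0, 0, 1), (5, -1, 1), (6, -1, 1), (0, -1, 1), (2, -1, 0), (1, -1, 0),
    (0, -1, 0), (4, -1, 0), (5, -1, 0), (0, 0, -1), (3, 0, -1), (2, 0, -1), (0, 1, -1),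
    (6, 0, 0), (4, 0, 0), (0, 1, 0)]),
  (2, [
    (2, 0, 0), (3, 0, 0), (0, 0, 0), (0, 1, 0)]),
  (2, [
    (0, 0, 1), (3, 0, 0), (1, 0, 0), (0, 1, 0)]),
  (1, [
    (0, 0, 1), (0, 0, 0), (1, 0, 0), (2, 0, 0)]),
  (2, [
    (0, 1, 0), (0, 0, 0), (6, 0, 0), (5, 0, 0)]),
  (3, [
    (0, 1, 0), (4, 0, 0), (6, 0, 0), (0, 1, -1)]),
  (2, [
    (4, 0, 0), (0, 0, 0), (0, 1, -1), (5, 0, 0)])]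

theorem tripleHole_certificate :
    tripleHoleData.Certificate tripleHoleTangencies tripleHoleRings := by
  decide +kernel

/-- Three touching small discs in each hole of the triangular packing. -/
theorem exists_packing_tripleHole {s : ℝ}
    (hs : s = 5 - 2 * √6)
    (hd : |s - 0.1010205144| < 1 / 10 ^ 10) :
    ∃ P : Set Disc, IsCompactPacking P ∧ HasExactRadii P s 1 := by
  rw [abs_lt] at hd
  obtain ⟨hl, hu⟩ := hd
  norm_num at hl hu
  have hs0 : 0 < s := by linarith
  have h1 : s ^ 2 - 10 * s + 1 = 0 := by
    have h6 : √6 ^ 2 = 6 := Real.sq_sqrt (by norm_num)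
    rw [hs]
    linear_combination 4 * h6
  obtain ⟨ht2, htl, htu⟩ := sqrt_three_bounds
  generalize √3 = t at *
  have hts := mul_bounds (by norm_num) (by norm_num) htl.le htu.le (a' := 0.1010205143)
    (b' := 0.1010205145) (y := s) (by linarith) (by linarith)
  norm_num at hts
  refine tripleHole_certificate.exists_packing (Q :=
    { ux := 2
      uy := 0
      wx := 1
      wy := t
      x := ![0, 1, 1 + s, 1 - s, 1, 1 + s, 1 - s]
      y := ![0, (t - 2 * (t * s)) / 3, (t + t * s) / 3, (t + t * s) / 3, -(t - 2 * (t * s)) / 3,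
        -(t + t * s) / 3, -(t + t * s) / 3]
      ρ := ![1, s, s, s, s, s, s]
      ρ_pos := by simp [Fin.forall_fin_succ, hs0] }) ?_ ?_ (by linarith) ?_
  · refine ⟨?_, ?_, ?_, ?_, ?_, ?_, ?_⟩ <;>
      simp [Fin.forall_fin_succ, tripleHoleData, abs_le]
    all_goals and_intros <;> linarith
  · simp only [tripleHoleTangencies, List.forall_mem_cons, List.not_mem_nil, false_imp_iff,
      implies_true, and_true]
    and_intros <;> simp [PeriodicFamily.Touches, PeriodicFamily.dx, PeriodicFamily.dy]
    all_goals grind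
  · ext z
    simp [eq_comm]

/-! ### The classification -/

/-- Every number of the table is the ratio of the radii of a compact packing. -/
theorem exists_packing_of_isTable {c : Fin 9 → ℝ} (h : IsTable c) (i : Fin 9) :
    ∃ P : Set Disc, IsCompactPacking P ∧ HasExactRadii P (c i) 1 := by
  fin_cases i
  · exact exists_packing_hexagonTiling h.exact1 h.decimal1
  · exact exists_packing_twistedKagome h.exact2 h.decimal2
  · exact exists_packing_zigzag h.exact3 h.decimal3
  · exact exists_packing_square h.exact4 h.decimal4
  · exact exists_packing_honeycomb h.exact5 h.decimal5
  · exact exists_packing_truncatedHexagonal h.exact6 h.decimal6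
  · exact exists_packing_rhombic h.exact7 h.decimal7
  · exact exists_packing_triangular h.exact8 h.decimal8
  · exact exists_packing_tripleHole h.exact9 h.decimal9

theorem IsTable.mem_Ioo {c : Fin 9 → ℝ} (h : IsTable c) (i : Fin 9) : c i ∈ Set.Ioo (0 : ℝ) 1 := by
  have hanti := (IsTable.strictAnti h).antitone
  have h0 := (abs_lt.1 h.decimal1).2
  have h8 := (abs_lt.1 h.decimal9).1
  norm_num at h0 h8
  have h9 : c 8 ≤ c i := hanti (Fin.le_last i)
  have h1 : c i ≤ c 0 := hanti (Fin.zero_le i)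
  exact ⟨by linarith, by linarith⟩

/-- The ratio of the radii of a compact packing is in the table. -/
theorem mem_range_of_packing {c : Fin 9 → ℝ} (h : IsTable c) {r : ℝ} (hr : 0 < r) (hr1 : r < 1)
    {P : Set Disc} (hP : IsCompactPacking P) (hPr : HasExactRadii P r 1) : r ∈ Set.range c := by
  have hpos := IsTable.mem_Ioo h
  rcases angle_equation_of_packing hr hr1 hP hPr rfl rfl with
    e | e | e | e | e | e | e | e | e
  · exact ⟨7, by rw [h.exact8, eq_of_three_alpha hr e]⟩
  · exact ⟨3, by rw [h.exact4, eq_of_four_alpha hr e]⟩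
  · exact ⟨8, by rw [h.exact9, eq_of_alpha_two_beta hr hr1 e]⟩
  · exact ⟨4, by rw [h.exact5, eq_of_alpha_two_beta' hr hr1 e]⟩
  · exact ⟨6, by rw [h.exact7, eq_of_two_alpha_two_beta hr e]⟩
  · obtain ⟨h1, h2⟩ := root_of_two_alpha_two_beta' hr e
    refine ⟨1, root_second_unique (hpos 1).1 hr h.exact2 ?_ h1 h2⟩
    have h3 := (abs_lt.1 h.decimal2).1
    norm_num at h3
    have h4 : 0 ≤ √3 * c 1 * (1 + c 1) := by have := (hpos 1).1; positivity
    nlinarith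
  · exact ⟨0, root_first_unique (hpos 0).1 hr (hpos 0).2 hr1 h.exact1
      (root_of_three_alpha_two_beta hr e)⟩
  · exact ⟨2, root_third_unique (hpos 2).1 hr h.exact3 (root_of_alpha_four_beta hr e)⟩
  · exact ⟨5, by rw [h.exact6, eq_of_four_beta hr e]⟩

end CompactPacking

theorem theorem1 :
    ∃ c : Fin 9 → ℝ, IsTable c ∧ Function.Injective c ∧
      {r : ℝ | r ∈ Set.Ioo (0 : ℝ) 1 ∧
        ∃ P : Set Disc, IsCompactPacking P ∧ HasExactRadii P r 1} = Set.range c := by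
  obtain ⟨x, hx, hx'⟩ := CompactPacking.exists_root_first
  obtain ⟨y, hy, hy'⟩ := CompactPacking.exists_root_second
  obtain ⟨z, hz, hz'⟩ := CompactPacking.exists_root_third
  have hc := CompactPacking.isTable_of_roots hx hx' hy hy' hz hz'
  refine ⟨_, hc, (CompactPacking.IsTable.strictAnti hc).injective, Set.Subset.antisymm ?_ ?_⟩
  · rintro r ⟨⟨hr, hr1⟩, P, hP, hPr⟩
    exact CompactPacking.mem_range_of_packing hc hr hr1 hP hPr
  · rintro _ ⟨i, rfl⟩
    exact ⟨CompactPacking.IsTable.mem_Ioo hc i, CompactPacking.exists_packing_of_isTable hc i⟩
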